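/- Let $\eta_1=\eta_1(x)$, $\eta_2=\eta_2(y)$ be real smooth functions, and let $\mathcal E$ be the infinite prolongation of the system $$u_{yy}=\frac{\tfrac12\eta_1' v^2v_x+\tfrac12\eta_2' uvu_y+(\eta_1-\eta_2)uu_yv_y+u^2v^3}{uv(\eta_1-\eta_2)},\qquad v_{xx}=\frac{\tfrac12\eta_1' uvv_x+\tfrac12\eta_2' u^2u_y+(\eta_2-\eta_1)vv_xu_x+u^3v^2}{uv(\eta_2-\eta_1)},$$ considered over a connected open set $\Omega$ of values of $(x,y,u,v)$ on which $\eta_1$, $\eta_2$ are smooth, $u\neq0$, $v\neq0$ and $\eta_1(x)\neq\eta_2(y)$. Internal coordinates on $\mathcal E$ are $x$, $y$, $u_{x^i}$, $u_{x^iy}$, $v_{y^j}$, $v_{xy^j}$ $(i,j\ge0)$, with $(x,y,u,v)\in\Omega$ and all other coordinates arbitrary real numbers; $D_x$, $D_y$ denote the total derivatives on $\mathcal E$. Substitute the formal expansion $w=w_0+w_1\mu+w_2\mu^2+\cdots$ with $w_0=e^{\theta_0}$ and $w_k=\theta_ke^{\theta_0}$ $(k>0)$ into $$w_x=i\sqrt{\frac{1+\eta_2\mu^2}{1+\eta_1\mu^2}}\,\frac{u_y}{v}\,w+\frac{u\mu}{2\sqrt{1+\eta_1\mu^2}}(1+w^2),\qquad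 w_y=-i\sqrt{\frac{1+\eta_1\mu^2}{1+\eta_2\mu^2}}\,\frac{v_x}{u}\,w+\frac{iv\mu}{2\sqrt{1+\eta_2\mu^2}}(1-w^2),$$ where the square roots are expanded in Taylor series at $\mu=0$. Equating the coefficients at the powers of $\mu$ gives expressions $\theta_{s,x}=P_s$, $\theta_{s,y}=Q_s$ $(s\ge0)$, in which $P_s$ and $Q_s$ are functions on $\mathcal E$ that depend also on $\theta_0,\dots,\theta_s$. For $l\ge0$ let $\mathcal E_l=\mathcal E\times\mathbb C^{l+1}$ with the complex fibre coordinates $\theta_0,\dots,\theta_l$, and let $$D_x^{[l]}=D_x+\sum_{s=0}^lP_s\frac{\partial}{\partial\theta_s},\qquad D_y^{[l]}=D_y+\sum_{s=0}^lQ_s\frac{\partial}{\partial\theta_s}.$$ Let $C^\infty(\mathcal E_l)$ be the set of complex-valued functions on $\mathcal E_l$ that depend on finitely many of the coordinates, are smooth in them, and are holomorphic in $\theta_0,\dots,\theta_l$. Then for every $l\ge0$ the solutions $f\in C^\infty(\mathcal E_l)$ of the system $$D_x^{[l]}(f)=0,\qquad D_y^{[l]}(f)=0$$ are exactly the constants.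 -/

import Mathlib

open scoped ContDiff

noncomputable section

namespace SDeformable

/-! ### The system `ℰ` in internal coordinates

The system expresses `u_yy` and `v_xx` through lower derivatives. Hence on its infinite prolongation
the derivatives `u_{x^i}`, `u_{x^i y}`, `v_{y^j}`, `v_{x y^j}` are independent and, together with
`x` and `y`, form a global coordinate system. -/

/-- Internal coordinates on `ℰ`: `u i = u_{x^i}`, `uy i = u_{x^i y}`, `v j = v_{y^j}`,
`vx j = v_{x y^j}`. -/
inductive Coord : Type
  | x : Coord
  | y : Coord
  | u : ℕ → Coord
  | uy : ℕ → Coord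
  | v : ℕ → Coord
  | vx : ℕ → Coord
  deriving DecidableEq

section TotalDerivatives

variable {F : Type*} [NormedAddCommGroup F] [NormedSpace ℝ F]

/-- The partial derivative `∂f/∂k` at `p`. -/
def pd (k : Coord) (f : (Coord → ℝ) → F) (p : Coord → ℝ) : F :=
  deriv (fun t : ℝ => f (Function.update p k t)) (p k)

/-- `∂_x + ∑ u_{x^{i+1}} ∂/∂u_{x^i} + ∑ u_{x^{i+1}y} ∂/∂u_{x^i y} + ∑ v_{xy^j} ∂/∂v_{y^j}
  + ∑ G_j ∂/∂v_{xy^j}`, where `G_j` stands for the expression of `v_{xxy^j}`. -/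
def dxWith (G : ℕ → (Coord → ℝ) → ℝ) (f : (Coord → ℝ) → F) (p : Coord → ℝ) : F :=
  pd .x f p + (∑ᶠ i, p (.u (i + 1)) • pd (.u i) f p) + (∑ᶠ i, p (.uy (i + 1)) • pd (.uy i) f p)
    + (∑ᶠ j, p (.vx j) • pd (.v j) f p) + (∑ᶠ j, G j p • pd (.vx j) f p)

/-- `∂_y + ∑ u_{x^i y} ∂/∂u_{x^i} + ∑ F_i ∂/∂u_{x^i y} + ∑ v_{y^{j+1}} ∂/∂v_{y^j}
  + ∑ v_{xy^{j+1}} ∂/∂v_{xy^j}`, where `F_i` stands for the expression of `u_{x^i yy}`. -/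
def dyWith (Φ : ℕ → (Coord → ℝ) → ℝ) (f : (Coord → ℝ) → F) (p : Coord → ℝ) : F :=
  pd .y f p + (∑ᶠ i, p (.uy i) • pd (.u i) f p) + (∑ᶠ i, Φ i p • pd (.uy i) f p)
    + (∑ᶠ j, p (.v (j + 1)) • pd (.v j) f p) + (∑ᶠ j, p (.vx (j + 1)) • pd (.vx j) f p)

end TotalDerivatives

/-- The right-hand side of the equation for `u_yy`. -/
def rhsU (η₁ η₂ : ℝ → ℝ) (p : Coord → ℝ) : ℝ :=
  (1 / 2 * deriv η₁ (p .x) * p (.v 0) ^ 2 * p (.vx 0)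
    + 1 / 2 * deriv η₂ (p .y) * p (.u 0) * p (.v 0) * p (.uy 0)
    + (η₁ (p .x) - η₂ (p .y)) * p (.u 0) * p (.uy 0) * p (.v 1)
    + p (.u 0) ^ 2 * p (.v 0) ^ 3)
  / (p (.u 0) * p (.v 0) * (η₁ (p .x) - η₂ (p .y)))

/-- The right-hand side of the equation for `v_xx`. -/
def rhsV (η₁ η₂ : ℝ → ℝ) (p : Coord → ℝ) : ℝ :=
  (1 / 2 * deriv η₁ (p .x) * p (.u 0) * p (.v 0) * p (.vx 0)
    + 1 / 2 * deriv η₂ (p .y) * p (.u 0) ^ 2 * p (.uy 0)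
    + (η₂ (p .y) - η₁ (p .x)) * p (.v 0) * p (.vx 0) * p (.u 1)
    + p (.u 0) ^ 3 * p (.v 0) ^ 2)
  / (p (.u 0) * p (.v 0) * (η₂ (p .y) - η₁ (p .x)))

/-- Stage `n` holds the expressions of `u_{x^i yy}` and of `v_{xxy^i}` for `i ≤ n` (and `0` in the
later places). The next stage adds `u_{x^{n+1}yy} = D_x u_{x^n yy}` and `v_{xxy^{n+1}} = D_y v_{xxy^n}`;
since `u_{x^n yy}` and `v_{xxy^n}` are expressed through coordinates of order at most `n + 1`, only
the entries already found take part in these derivatives. -/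
def stage (η₁ η₂ : ℝ → ℝ) : ℕ → (ℕ → (Coord → ℝ) → ℝ) × (ℕ → (Coord → ℝ) → ℝ)
  | 0 => (Function.update (fun _ _ => 0) 0 (rhsU η₁ η₂), Function.update (fun _ _ => 0) 0 (rhsV η₁ η₂))
  | n + 1 =>
    (Function.update (stage η₁ η₂ n).1 (n + 1)
        (dxWith (stage η₁ η₂ n).2 ((stage η₁ η₂ n).1 n)),
      Function.update (stage η₁ η₂ n).2 (n + 1)
        (dyWith (stage η₁ η₂ n).1 ((stage η₁ η₂ n).2 n)))

/-- `u_{x^i yy}` as a function on `ℰ`. -/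
def uyy (η₁ η₂ : ℝ → ℝ) (i : ℕ) : (Coord → ℝ) → ℝ := (stage η₁ η₂ i).1 i

/-- `v_{xxy^j}` as a function on `ℰ`. -/
def vxx (η₁ η₂ : ℝ → ℝ) (j : ℕ) : (Coord → ℝ) → ℝ := (stage η₁ η₂ j).2 j

/-- The total derivative `D_x` on `ℰ`. -/
def Dx {F : Type*} [NormedAddCommGroup F] [NormedSpace ℝ F] (η₁ η₂ : ℝ → ℝ)
    (f : (Coord → ℝ) → F) : (Coord → ℝ) → F :=
  dxWith (vxx η₁ η₂) f

/-- The total derivative `D_y` on `ℰ`. -/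
def Dy {F : Type*} [NormedAddCommGroup F] [NormedSpace ℝ F] (η₁ η₂ : ℝ → ℝ)
    (f : (Coord → ℝ) → F) : (Coord → ℝ) → F :=
  dyWith (uyy η₁ η₂) f

/-! #### The stages fit together: `D_x u_{x^i yy} = u_{x^{i+1}yy}`, `D_y v_{xxy^j} = v_{xxy^{j+1}}` -/

/-- The order of a coordinate. -/
def Coord.order : Coord → ℕ
  | .x => 0
  | .y => 0
  | .u i => i
  | .uy i => i + 1
  | .v j => j
  | .vx j => j + 1

/-- `f` depends on coordinates of order at most `n` only. -/
def OrderLE {F : Type*} (n : ℕ) (f : (Coord → ℝ) → F) : Prop :=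
  ∀ p q : Coord → ℝ, (∀ k, k.order ≤ n → p k = q k) → f p = f q

theorem OrderLE.mono {F : Type*} {m n : ℕ} {f : (Coord → ℝ) → F} (h : OrderLE m f) (hmn : m ≤ n) :
    OrderLE n f :=
  fun p q hpq => h p q fun k hk => hpq k (hk.trans hmn)

theorem OrderLE.pd_eq_zero {n : ℕ} {f : (Coord → ℝ) → ℝ} (h : OrderLE n f) {k : Coord}
    (hk : n < k.order) (p : Coord → ℝ) : pd k f p = 0 := by
  have : (fun t : ℝ => f (Function.update p k t)) = fun _ => f p := by
    funext t
    refine h _ _ fun k' hk' => ?_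
    rw [Function.update_of_ne]
    rintro rfl
    omega
  simp [pd, this]

theorem OrderLE.pd {n : ℕ} {f : (Coord → ℝ) → ℝ} (h : OrderLE n f) (k : Coord) :
    OrderLE n (pd k f) := by
  intro p q hpq
  by_cases hk : n < k.order
  · rw [h.pd_eq_zero hk, h.pd_eq_zero hk]
  · have : (fun t : ℝ => f (Function.update p k t)) = fun t => f (Function.update q k t) := by
      funext t
      refine h _ _ fun k' hk' => ?_
      by_cases e : k' = k
      · subst e; simp
      · simp [Function.update_of_ne e, hpq k' hk']
    simp only [SDeformable.pd]
    rw [this, hpq k (by omega)]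

theorem OrderLE.finsum_smul_pd {n : ℕ} {f : (Coord → ℝ) → ℝ} (h : OrderLE n f) (κ : ℕ → Coord)
    {a : ℕ → (Coord → ℝ) → ℝ} (ha : ∀ i, (κ i).order ≤ n → OrderLE (n + 1) (a i)) :
    OrderLE (n + 1) (fun p => ∑ᶠ i, a i p • SDeformable.pd (κ i) f p) := by
  intro p q hpq
  refine finsum_congr fun i => ?_
  by_cases hi : n < (κ i).order
  · rw [h.pd_eq_zero hi, h.pd_eq_zero hi, smul_zero, smul_zero]
  · rw [ha i (by omega) p q hpq, (h.pd (κ i)).mono (Nat.le_succ n) p q hpq]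

theorem orderLE_coord {n : ℕ} {k : Coord} (hk : k.order ≤ n) : OrderLE n (fun p => p k) :=
  fun _ _ h => h k hk

theorem OrderLE.dxWith {n : ℕ} {f : (Coord → ℝ) → ℝ} (h : OrderLE n f)
    {G : ℕ → (Coord → ℝ) → ℝ} (hG : ∀ j, j + 1 ≤ n → OrderLE (n + 1) (G j)) :
    OrderLE (n + 1) (dxWith G f) := by
  intro p q hpq
  have h1 := (h.pd .x).mono (Nat.le_succ n) p q hpq
  have h2 := h.finsum_smul_pd .u (a := fun i p => p (.u (i + 1)))
    (fun i hi => orderLE_coord (by simp [Coord.order] at hi ⊢; omega)) p q hpq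
  have h3 := h.finsum_smul_pd .uy (a := fun i p => p (.uy (i + 1)))
    (fun i hi => orderLE_coord (by simp [Coord.order] at hi ⊢; omega)) p q hpq
  have h4 := h.finsum_smul_pd .v (a := fun i p => p (.vx i))
    (fun i hi => orderLE_coord (by simp [Coord.order] at hi ⊢; omega)) p q hpq
  have h5 := h.finsum_smul_pd .vx (a := G) (fun i hi => hG i hi) p q hpq
  simp only [SDeformable.dxWith]
  simp only at h2 h3 h4 h5
  rw [h1, h2, h3, h4, h5]

theorem OrderLE.dyWith {n : ℕ} {f : (Coord → ℝ) → ℝ} (h : OrderLE n f)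
    {G : ℕ → (Coord → ℝ) → ℝ} (hG : ∀ j, j + 1 ≤ n → OrderLE (n + 1) (G j)) :
    OrderLE (n + 1) (dyWith G f) := by
  intro p q hpq
  have h1 := (h.pd .y).mono (Nat.le_succ n) p q hpq
  have h2 := h.finsum_smul_pd .u (a := fun i p => p (.uy i))
    (fun i hi => orderLE_coord (by simp [Coord.order] at hi ⊢; omega)) p q hpq
  have h3 := h.finsum_smul_pd .uy (a := G) (fun i hi => hG i hi) p q hpq
  have h4 := h.finsum_smul_pd .v (a := fun i p => p (.v (i + 1)))
    (fun i hi => orderLE_coord (by simp [Coord.order] at hi ⊢; omega)) p q hpq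
  have h5 := h.finsum_smul_pd .vx (a := fun i p => p (.vx (i + 1)))
    (fun i hi => orderLE_coord (by simp [Coord.order] at hi ⊢; omega)) p q hpq
  simp only [SDeformable.dyWith]
  simp only at h2 h3 h4 h5
  rw [h1, h2, h3, h4, h5]

theorem stage_eq (η₁ η₂ : ℝ → ℝ) (n : ℕ) : ∀ i ≤ n,
    (stage η₁ η₂ n).1 i = uyy η₁ η₂ i ∧ (stage η₁ η₂ n).2 i = vxx η₁ η₂ i := by
  induction n with
  | zero =>
    intro i hi
    obtain rfl : i = 0 := by omega
    exact ⟨rfl, rfl⟩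
  | succ n ih =>
    intro i hi
    rcases Nat.lt_or_ge n i with h | h
    · obtain rfl : i = n + 1 := by omega
      exact ⟨rfl, rfl⟩
    · have hne : i ≠ n + 1 := by omega
      have := ih i h
      simpa [stage, Function.update_of_ne hne] using this

theorem orderLE_uyy_vxx (η₁ η₂ : ℝ → ℝ) (n : ℕ) : ∀ i ≤ n,
    OrderLE (i + 1) (uyy η₁ η₂ i) ∧ OrderLE (i + 1) (vxx η₁ η₂ i) := by
  induction n with
  | zero =>
    intro i hi
    obtain rfl : i = 0 := by omega
    constructor <;> intro p q h
    · simp only [uyy, stage, Function.update_self, rhsU]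
      rw [h .x (by simp [Coord.order]), h .y (by simp [Coord.order]), h (.u 0) (by simp [Coord.order]),
        h (.v 0) (by simp [Coord.order]), h (.vx 0) (by simp [Coord.order]),
        h (.uy 0) (by simp [Coord.order]), h (.v 1) (by simp [Coord.order])]
    · simp only [vxx, stage, Function.update_self, rhsV]
      rw [h .x (by simp [Coord.order]), h .y (by simp [Coord.order]), h (.u 0) (by simp [Coord.order]),
        h (.v 0) (by simp [Coord.order]), h (.vx 0) (by simp [Coord.order]),
        h (.uy 0) (by simp [Coord.order]), h (.u 1) (by simp [Coord.order])]
  | succ n ih =>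
    intro i hi
    rcases Nat.lt_or_ge n i with h | h
    · obtain rfl : i = n + 1 := by omega
      constructor
      · simp only [uyy, stage, Function.update_self]
        refine OrderLE.dxWith ?_ fun j hj => ?_
        · rw [(stage_eq η₁ η₂ n n le_rfl).1]; exact (ih n le_rfl).1
        · rw [(stage_eq η₁ η₂ n j (by omega)).2]; exact (ih j (by omega)).2.mono (by omega)
      · simp only [vxx, stage, Function.update_self]
        refine OrderLE.dyWith ?_ fun j hj => ?_
        · rw [(stage_eq η₁ η₂ n n le_rfl).2]; exact (ih n le_rfl).2
        · rw [(stage_eq η₁ η₂ n j (by omega)).1]; exact (ih j (by omega)).1.mono (by omega)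
    · exact ih i h

theorem uyy_zero (η₁ η₂ : ℝ → ℝ) : uyy η₁ η₂ 0 = rhsU η₁ η₂ := by simp [uyy, stage]

theorem vxx_zero (η₁ η₂ : ℝ → ℝ) : vxx η₁ η₂ 0 = rhsV η₁ η₂ := by simp [vxx, stage]

theorem uyy_succ (η₁ η₂ : ℝ → ℝ) (i : ℕ) : uyy η₁ η₂ (i + 1) = Dx η₁ η₂ (uyy η₁ η₂ i) := by
  have h := (orderLE_uyy_vxx η₁ η₂ i i le_rfl).1
  conv_lhs => simp only [uyy, stage, Function.update_self]
  rw [(stage_eq η₁ η₂ i i le_rfl).1]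
  funext p
  simp only [Dx, dxWith]
  congr 1
  refine finsum_congr fun j => ?_
  by_cases hj : j ≤ i
  · rw [(stage_eq η₁ η₂ i j hj).2]
  · rw [h.pd_eq_zero (by simp [Coord.order]; omega), smul_zero, smul_zero]

theorem vxx_succ (η₁ η₂ : ℝ → ℝ) (j : ℕ) : vxx η₁ η₂ (j + 1) = Dy η₁ η₂ (vxx η₁ η₂ j) := by
  have h := (orderLE_uyy_vxx η₁ η₂ j j le_rfl).2
  conv_lhs => simp only [vxx, stage, Function.update_self]
  rw [(stage_eq η₁ η₂ j j le_rfl).2]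
  funext p
  simp only [Dy, dyWith]
  congr 3
  refine finsum_congr fun i => ?_
  by_cases hi : i ≤ j
  · rw [(stage_eq η₁ η₂ j i hi).1]
  · rw [h.pd_eq_zero (by simp [Coord.order]; omega), smul_zero, smul_zero]

/-! ### The tower of coverings `ℰ_l` -/

/-- The formal Taylor series at `μ = 0` of a real function of `μ`. -/
def taylorSeries (φ : ℝ → ℝ) : PowerSeries ℂ :=
  PowerSeries.mk fun n => ((iteratedDeriv n φ 0 / (Nat.factorial n : ℝ) : ℝ) : ℂ)

/-- The expansion of `1 / √(1 + c μ²)`. -/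
def invSqrtSeries (c : ℝ) : PowerSeries ℂ :=
  taylorSeries fun μ => 1 / √(1 + c * μ ^ 2)

/-- The expansion of `√((1 + c μ²) / (1 + d μ²))`. -/
def sqrtRatioSeries (c d : ℝ) : PowerSeries ℂ :=
  taylorSeries fun μ => √((1 + c * μ ^ 2) / (1 + d * μ ^ 2))

/-- The series `w = w₀ + w₁ μ + w₂ μ² + ⋯` with `w₀ = e^{θ₀}` and `w_k = θ_k e^{θ₀}` for `k > 0`. -/
def wSeries (θ : ℕ → ℂ) : PowerSeries ℂ :=
  PowerSeries.mk fun k => if k = 0 then Complex.exp (θ 0) else θ k * Complex.exp (θ 0)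

/-- The right-hand side of the `x`-part of the Riccati covering,
`w_x = i √((1 + η₂ μ²)/(1 + η₁ μ²)) (u_y / v) w + u μ / (2 √(1 + η₁ μ²)) (1 + w²)`,
expanded in `μ`. -/
def riccatiX (η₁ η₂ : ℝ → ℝ) (p : Coord → ℝ) (θ : ℕ → ℂ) : PowerSeries ℂ :=
  PowerSeries.C (Complex.I * (p (.uy 0) / p (.v 0) : ℝ))
      * sqrtRatioSeries (η₂ (p .y)) (η₁ (p .x)) * wSeries θ
    + PowerSeries.C ((p (.u 0) / 2 : ℝ) : ℂ) * PowerSeries.X * invSqrtSeries (η₁ (p .x))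
      * (1 + wSeries θ ^ 2)

/-- The right-hand side of the `y`-part of the Riccati covering,
`w_y = -i √((1 + η₁ μ²)/(1 + η₂ μ²)) (v_x / u) w + i v μ / (2 √(1 + η₂ μ²)) (1 - w²)`,
expanded in `μ`. -/
def riccatiY (η₁ η₂ : ℝ → ℝ) (p : Coord → ℝ) (θ : ℕ → ℂ) : PowerSeries ℂ :=
  -(PowerSeries.C (Complex.I * (p (.vx 0) / p (.u 0) : ℝ))
      * sqrtRatioSeries (η₁ (p .x)) (η₂ (p .y)) * wSeries θ)
    + PowerSeries.C (Complex.I * (p (.v 0) / 2 : ℝ)) * PowerSeries.X * invSqrtSeries (η₂ (p .y))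
      * (1 - wSeries θ ^ 2)

/-- The passage from `(w₀', w₁', …)` to `(θ₀', θ₁', …)` under `w₀ = e^{θ₀}`, `w_k = θ_k e^{θ₀}`:
`θ₀' = e^{-θ₀} w₀'` and `θ_k' = e^{-θ₀} w_k' - θ_k θ₀'`. -/
def thetaDot (R : PowerSeries ℂ) (θ : ℕ → ℂ) (k : ℕ) : ℂ :=
  if k = 0 then Complex.exp (-θ 0) * PowerSeries.coeff 0 R
  else Complex.exp (-θ 0) * PowerSeries.coeff k R
    - θ k * (Complex.exp (-θ 0) * PowerSeries.coeff 0 R)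

/-- The variables `θ₀, …, θ_l` as a sequence; the first `l + 1` components of the tower do not
involve the later entries. -/
def extend {l : ℕ} (θ : Fin (l + 1) → ℂ) (k : ℕ) : ℂ :=
  if h : k < l + 1 then θ ⟨k, h⟩ else 0

/-- The partial derivative `∂f/∂θ_s`. -/
def pdθ {l : ℕ} (s : Fin (l + 1)) (f : (Fin (l + 1) → ℂ) → ℂ) (θ : Fin (l + 1) → ℂ) : ℂ :=
  deriv (fun z : ℂ => f (Function.update θ s z)) (θ s)

/-- The total derivative `D_x^{[l]} = D_x + ∑_{s ≤ l} θ_{s,x} ∂/∂θ_s` on `ℰ_l`. -/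
def DxL (η₁ η₂ : ℝ → ℝ) (l : ℕ) (f : (Coord → ℝ) → (Fin (l + 1) → ℂ) → ℂ)
    (p : Coord → ℝ) (θ : Fin (l + 1) → ℂ) : ℂ :=
  Dx η₁ η₂ (fun p' => f p' θ) p
    + ∑ s : Fin (l + 1), thetaDot (riccatiX η₁ η₂ p (extend θ)) (extend θ) s * pdθ s (f p) θ

/-- The total derivative `D_y^{[l]} = D_y + ∑_{s ≤ l} θ_{s,y} ∂/∂θ_s` on `ℰ_l`. -/
def DyL (η₁ η₂ : ℝ → ℝ) (l : ℕ) (f : (Coord → ℝ) → (Fin (l + 1) → ℂ) → ℂ)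
    (p : Coord → ℝ) (θ : Fin (l + 1) → ℂ) : ℂ :=
  Dy η₁ η₂ (fun p' => f p' θ) p
    + ∑ s : Fin (l + 1), thetaDot (riccatiY η₁ η₂ p (extend θ)) (extend θ) s * pdθ s (f p) θ

/-- The part of `ℰ` lying over a set `Ω` of values of `(x, y, u, v)`. The covering space `ℰ_l` over
it is its product with the space of all `θ : Fin (l + 1) → ℂ`. -/
def equationOver (Ω : Set (ℝ × ℝ × ℝ × ℝ)) : Set (Coord → ℝ) :=
  {p | (p .x, p .y, p (.u 0), p (.v 0)) ∈ Ω}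

/-- `f ∈ C^∞(ℰ_l)`: `f` depends on finitely many coordinates of `ℰ` and on `θ₀, …, θ_l`, is smooth in
all of them jointly, and is holomorphic in the complex variables `θ₀, …, θ_l`. -/
structure IsSmoothOn (Ω : Set (ℝ × ℝ × ℝ × ℝ)) (l : ℕ)
    (f : (Coord → ℝ) → (Fin (l + 1) → ℂ) → ℂ) : Prop where
  finite_order : ∃ K : Finset Coord,
    (∀ p ∈ equationOver Ω, ∀ q ∈ equationOver Ω, (∀ k ∈ K, p k = q k) → f p = f q) ∧
    ∀ p ∈ equationOver Ω, ∀ θ : Fin (l + 1) → ℂ,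
      ContDiffAt ℝ ∞
        (fun q : (K → ℝ) × (Fin (l + 1) → ℂ) => f (Function.updateFinset p K q.1) q.2)
        (K.restrict p, θ)
  holomorphic : ∀ p ∈ equationOver Ω, Differentiable ℂ (f p)

end SDeformable

end

/-!
Let `f` be annihilated by `D_x^{[l]}` and `D_y^{[l]}`. The right-hand sides of the covering involve
only `x`, `y`, `u`, `v`, `u_y` and `v_x`. If `f` is locally independent of all coordinates of order
above `n`, then varying a coordinate of order `n + 1` in `D_x^{[l]} f = 0` or `D_y^{[l]} f = 0`
removes the coordinates of order `n`; so locally `f` is a function of `x`, `y` and `θ` alone.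

Now vary `u_y`, `u`, `v_x` and `v` separately, with `x`, `y` and `θ` fixed. On each fibre `f` is
then annihilated by the Riccati fields `w' = r w`, `w' = μ s₁ (1 + w²)`, `w' = -r' w` and
`w' = μ s₂ (1 - w²)`, where the power series `r`, `r'`, `s₁`, `s₂` in `μ` have constant term `1`.
The fields `w' = a + b w + c w²` form `sl₂` over the power series, and `r - r' = (η₂ - η₁) μ² + ⋯`
has order exactly two because `η₁ ≠ η₂`. Bracketing with `w' = (r - r') w` hence raises the order of
the fields in `1 ± w²` by two, and brackets of these with one another give fields in `w`, so for
each `n` some annihilating field has leading term `μ ^ n`. In the coordinates `θ` these fields are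
triangular, whence `∂f/∂θ = 0`. The two equations then reduce to `∂f/∂x = ∂f/∂y = 0`, and `f` is
constant by connectedness.
-/

noncomputable section

namespace SDeformable

open Filter Topology Function PowerSeries

section LocalIndependence

variable {Ω : Set (ℝ × ℝ × ℝ × ℝ)} {l : ℕ} {f : (Coord → ℝ) → (Fin (l + 1) → ℂ) → ℂ}
  {p : Coord → ℝ} {c : Coord}

theorem isOpen_equationOver (hopen : IsOpen Ω) : IsOpen (equationOver Ω) :=
  hopen.preimage (by fun_prop : Continuous fun p : Coord → ℝ => (p .x, p .y, p (.u 0), p (.v 0)))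

theorem eventually_update_mem_equationOver (hopen : IsOpen Ω) (hp : p ∈ equationOver Ω)
    (c : Coord) :
    ∀ᶠ z : ℝ × (Coord → ℝ) in 𝓝 (p c) ×ˢ 𝓝 p, update z.2 c z.1 ∈ equationOver Ω := by
  rw [← nhds_prod_eq]
  exact (continuous_snd.update c continuous_fst).continuousAt.eventually_mem
    ((isOpen_equationOver hopen).mem_nhds (by simpa using hp))

theorem isPreconnected_equationOver (hconn : IsPreconnected Ω) :
    IsPreconnected (equationOver Ω) := by
  let γ : (ℝ × ℝ × ℝ × ℝ) × (Coord → ℝ) → Coord → ℝ := fun z =>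
    update (update (update (update z.2 .x z.1.1) .y z.1.2.1) (.u 0) z.1.2.2.1) (.v 0) z.1.2.2.2
  have hγ : Continuous γ := by fun_prop
  have himage : γ '' (Ω ×ˢ Set.univ) = equationOver Ω := by
    refine Set.Subset.antisymm ?_ fun p hp => ⟨((p .x, p .y, p (.u 0), p (.v 0)), p), ?_, ?_⟩
    · rintro _ ⟨z, hz, rfl⟩
      simpa [equationOver, γ] using hz.1
    · exact ⟨hp, Set.mem_univ p⟩
    · simp [γ]
  exact himage ▸ (hconn.prod isPreconnected_univ).image γ hγ.continuousOn

theorem IsSmoothOn.contDiffAt_comp (hopen : IsOpen Ω) (hf : IsSmoothOn Ω l f) {V : Type*}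
    [NormedAddCommGroup V] [NormedSpace ℝ V] {γ : V → Coord → ℝ} {τ : V → Fin (l + 1) → ℂ} {a : V}
    (hγ : ∀ k, ContDiffAt ℝ ∞ (fun v => γ v k) a) (hτ : ContDiffAt ℝ ∞ τ a)
    (ha : γ a ∈ equationOver Ω) : ContDiffAt ℝ ∞ (fun v => f (γ v) (τ v)) a := by
  obtain ⟨K, hK, hsmooth⟩ := hf.finite_order
  have hrestrict : ContDiffAt ℝ ∞ (fun v => K.restrict (γ v)) a :=
    contDiffAt_pi.mpr fun k => hγ k
  refine ((hsmooth _ ha (τ a)).comp a (hrestrict.prodMk hτ)).congr_of_eventuallyEq ?_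
  have hγc : ContinuousAt γ a := continuousAt_pi.mpr fun k => (hγ k).continuousAt
  have hγK : ContinuousAt (fun v => updateFinset (γ a) K (K.restrict (γ v))) a := by
    refine continuousAt_pi.mpr fun k => ?_
    by_cases hk : k ∈ K
    · simpa [updateFinset, hk] using (hγ k).continuousAt
    · simpa [updateFinset, hk] using continuousAt_const
  have ha' : updateFinset (γ a) K (K.restrict (γ a)) = γ a := by
    funext k
    by_cases hk : k ∈ K <;> simp [updateFinset, hk]
  filter_upwards [hγc.eventually_mem ((isOpen_equationOver hopen).mem_nhds ha),
    hγK.eventually_mem ((isOpen_equationOver hopen).mem_nhds (ha'.symm ▸ ha))] with v hv hvK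
  exact congrFun (hK _ hv _ hvK fun k hk => by simp [updateFinset, hk]) (τ v)

theorem IsSmoothOn.contDiff (hopen : IsOpen Ω) (hf : IsSmoothOn Ω l f)
    (hp : p ∈ equationOver Ω) : ContDiff ℝ ∞ (f p) :=
  contDiff_iff_contDiffAt.mpr fun _ =>
    hf.contDiffAt_comp hopen (γ := fun _ => p) (fun _ => contDiffAt_const) contDiffAt_id hp

theorem contDiffAt_update (p : Coord → ℝ) {c : Coord} {t : ℝ} (k : Coord) :
    ContDiffAt ℝ ∞ (fun s => update p c s k) t := by
  obtain rfl | h := eq_or_ne k c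
  · simpa using contDiffAt_fun_id
  · simpa [update_of_ne h] using contDiffAt_const

theorem IsSmoothOn.differentiableAt_update (hopen : IsOpen Ω) (hf : IsSmoothOn Ω l f) {t : ℝ}
    (hp : update p c t ∈ equationOver Ω) (θ : Fin (l + 1) → ℂ) :
    DifferentiableAt ℝ (fun s : ℝ => f (update p c s) θ) t :=
  (hf.contDiffAt_comp hopen (τ := fun _ => θ) (contDiffAt_update p)
    contDiffAt_const hp).differentiableAt (by simp)

theorem pd_eq_zero_of_forall_update_eq {F : Type*} [NormedAddCommGroup F] [NormedSpace ℝ F]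
    {g : (Coord → ℝ) → F} {z : F} (hopen : IsOpen Ω) (hp : p ∈ equationOver Ω)
    (hg : ∀ t, update p c t ∈ equationOver Ω → g (update p c t) = z) : pd c g p = 0 := by
  have hconst : (fun t => g (update p c t)) =ᶠ[𝓝 (p c)] fun _ => z := by
    filter_upwards [(eventually_update_mem_equationOver hopen hp c).curry] with t ht
    exact hg t ht.self_of_nhds
  rw [pd, hconst.deriv_eq, deriv_const]

theorem IsSmoothOn.exists_finset_pd_eq_zero (hopen : IsOpen Ω) (hf : IsSmoothOn Ω l f) :
    ∃ K : Finset Coord, ∀ p ∈ equationOver Ω, ∀ θ, ∀ k ∉ K, pd k (fun q => f q θ) p = 0 := by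
  obtain ⟨K, hK, -⟩ := hf.finite_order
  exact ⟨K, fun p hp θ k hk => pd_eq_zero_of_forall_update_eq hopen hp fun t ht =>
    congrFun (hK _ ht p hp fun i hi => update_of_ne (ne_of_mem_of_not_mem hi hk) t p) θ⟩

/-- `f` is locally independent of the coordinate `k`: the partial derivative `∂f/∂k` vanishes over
`Ω`. -/
def IsLocallyIndep (Ω : Set (ℝ × ℝ × ℝ × ℝ)) (f : (Coord → ℝ) → (Fin (l + 1) → ℂ) → ℂ)
    (k : Coord) : Prop :=
  ∀ p ∈ equationOver Ω, ∀ θ, pd k (fun q => f q θ) p = 0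

theorem IsLocallyIndep.eventually_update_eq (hopen : IsOpen Ω) (hf : IsSmoothOn Ω l f)
    (hc : IsLocallyIndep Ω f c) (hp : p ∈ equationOver Ω) :
    ∀ᶠ z : ℝ × (Coord → ℝ) in 𝓝 (p c) ×ˢ 𝓝 p, f (update z.2 c z.1) = f z.2 := by
  obtain ⟨⟨ε, U⟩, ⟨hε, hU⟩, hmem⟩ :=
    (Metric.nhds_basis_ball.prod (𝓝 p).basis_sets).eventually_iff.mp
      (eventually_update_mem_equationOver hopen hp c)
  have hball := (continuous_apply c).continuousAt.eventually_mem (Metric.ball_mem_nhds (p c) hε)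
  filter_upwards [prod_mem_prod (Metric.ball_mem_nhds (p c) hε) (inter_mem hU hball)]
    with ⟨t, q⟩ ⟨ht, hq, hqc⟩
  have hupdate : ∀ s ∈ Metric.ball (p c) ε, update q c s ∈ equationOver Ω :=
    fun s hs => hmem (x := (s, q)) ⟨hs, hq⟩
  funext θ
  have hconst := Metric.isOpen_ball.is_const_of_deriv_eq_zero
    (convex_ball (p c) ε).isPreconnected
    (fun s hs => (hf.differentiableAt_update hopen (hupdate s hs) θ).differentiableWithinAt)
    (fun s hs => by simpa [pd] using hc _ (hupdate s hs) θ) ht hqc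
  simpa using hconst

theorem IsLocallyIndep.exists_update (hopen : IsOpen Ω) (hf : IsSmoothOn Ω l f)
    (hc : IsLocallyIndep Ω f c) (hp : p ∈ equationOver Ω) :
    ∃ t ≠ p c, update p c t ∈ equationOver Ω ∧ f (update p c t) = f p ∧
      ∀ k θ, pd k (fun q => f q θ) (update p c t) = pd k (fun q => f q θ) p := by
  have hmem := (eventually_update_mem_equationOver hopen hp c).curry
  have heq := (hc.eventually_update_eq hopen hf hp).curry
  obtain ⟨t, ⟨htmem, ht⟩, htne⟩ :=
    (((hmem.and heq).filter_mono nhdsWithin_le_nhds).and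
      (eventually_mem_nhdsWithin (a := p c) (s := {p c}ᶜ))).exists
  refine ⟨t, htne, htmem.self_of_nhds, ht.self_of_nhds, fun k θ => ?_⟩
  obtain rfl | hk := eq_or_ne k c
  · rw [hc _ htmem.self_of_nhds, hc _ hp]
  have hcomm : (fun s => f (update (update p c t) k s) θ) =ᶠ[𝓝 (p k)]
      fun s => f (update p k s) θ := by
    have hlim : Tendsto (update p k) (𝓝 (p k)) (𝓝 p) := by
      simpa using ((continuous_const (y := p)).update k continuous_id).tendsto (p k)
    filter_upwards [hlim.eventually ht] with s hs
    rw [update_comm hk.symm, hs]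
  rw [pd, update_of_ne hk, hcomm.deriv_eq, pd]

end LocalIndependence

section FirstIntegrals

variable {Ω : Set (ℝ × ℝ × ℝ × ℝ)} {l : ℕ} {f : (Coord → ℝ) → (Fin (l + 1) → ℂ) → ℂ}
  {p : Coord → ℝ} {a : Coord → (Coord → ℝ) → ℝ}
  {R : (Coord → ℝ) → (Fin (l + 1) → ℂ) → Fin (l + 1) → ℂ}

theorem Coord.univ_eq : (Set.univ : Set Coord) = insert .x (insert .y
    (Set.range .u ∪ (Set.range .uy ∪ (Set.range .v ∪ Set.range .vx)))) := by
  ext k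
  cases k <;> simp

theorem finsum_coord {F : Type*} [AddCommMonoid F] {g : Coord → F} (hg : (support g).Finite) :
    ∑ᶠ k, g k = g .x + (g .y + ((∑ᶠ i, g (.u i)) + ((∑ᶠ i, g (.uy i))
      + ((∑ᶠ j, g (.v j)) + ∑ᶠ j, g (.vx j))))) := by
  have hfin (s : Set Coord) : (s ∩ support g).Finite := hg.inter_of_right s
  rw [← finsum_mem_univ, Coord.univ_eq, finsum_mem_insert' _ (by simp) (hfin _),
    finsum_mem_insert' _ (by simp) (hfin _),
    finsum_mem_union' (by simp [Set.disjoint_left]) (hfin _) (hfin _),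
    finsum_mem_union' (by simp [Set.disjoint_left]) (hfin _) (hfin _),
    finsum_mem_union' (by simp [Set.disjoint_left]) (hfin _) (hfin _),
    finsum_mem_range fun _ _ => Coord.u.inj, finsum_mem_range fun _ _ => Coord.uy.inj,
    finsum_mem_range fun _ _ => Coord.v.inj, finsum_mem_range fun _ _ => Coord.vx.inj]

/-- The coefficients `D_x(k)` of the vector field `dxWith G = ∑ D_x(k) ∂/∂k`. -/
def dxCoord (G : ℕ → (Coord → ℝ) → ℝ) : Coord → (Coord → ℝ) → ℝ
  | .x, _ => 1
  | .y, _ => 0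
  | .u i, p => p (.u (i + 1))
  | .uy i, p => p (.uy (i + 1))
  | .v j, p => p (.vx j)
  | .vx j, p => G j p

/-- The coefficients `D_y(k)` of the vector field `dyWith Φ = ∑ D_y(k) ∂/∂k`. -/
def dyCoord (Φ : ℕ → (Coord → ℝ) → ℝ) : Coord → (Coord → ℝ) → ℝ
  | .x, _ => 0
  | .y, _ => 1
  | .u i, p => p (.uy i)
  | .uy i, p => Φ i p
  | .v j, p => p (.v (j + 1))
  | .vx j, p => p (.vx (j + 1))

theorem dxWith_eq_finsum (G : ℕ → (Coord → ℝ) → ℝ) {F : Type*} [NormedAddCommGroup F]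
    [NormedSpace ℝ F] {g : (Coord → ℝ) → F} (hg : (support fun k => pd k g p).Finite) :
    dxWith G g p = ∑ᶠ k, dxCoord G k p • pd k g p := by
  rw [finsum_coord (hg.subset fun k hk => right_ne_zero_of_smul hk)]
  simp only [dxWith, dxCoord, one_smul, zero_smul, zero_add, add_assoc]

theorem dyWith_eq_finsum (Φ : ℕ → (Coord → ℝ) → ℝ) {F : Type*} [NormedAddCommGroup F]
    [NormedSpace ℝ F] {g : (Coord → ℝ) → F} (hg : (support fun k => pd k g p).Finite) :
    dyWith Φ g p = ∑ᶠ k, dyCoord Φ k p • pd k g p := by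
  rw [finsum_coord (hg.subset fun k hk => right_ne_zero_of_smul hk)]
  simp only [dyWith, dyCoord, one_smul, zero_smul, zero_add, add_assoc]

theorem sum_mul_pdθ {g : (Fin (l + 1) → ℂ) → ℂ} (hg : Differentiable ℂ g)
    (ξ θ : Fin (l + 1) → ℂ) : ∑ s, ξ s * pdθ s g θ = fderiv ℂ g θ ξ := by
  have hpd (s) : pdθ s g θ = fderiv ℂ g θ (Pi.single s 1) := by
    have hs : HasFDerivAt g (fderiv ℂ g θ) (update θ s (θ s)) := by
      simpa using (hg θ).hasFDerivAt
    exact (hs.comp_hasDerivAt (θ s) (hasDerivAt_update θ s (θ s))).deriv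
  conv_rhs => rw [← Finset.univ_sum_single ξ, map_sum]
  exact Finset.sum_congr rfl fun s _ => by
    rw [hpd, ← smul_eq_mul, ← map_smul, ← Pi.single_smul, smul_eq_mul, mul_one]

/-- `f` is a first integral, over `Ω`, of the vector field with the coefficients `a k` at `∂/∂k` and
with the fibre component `R`. -/
def IsFirstIntegral (Ω : Set (ℝ × ℝ × ℝ × ℝ)) (a : Coord → (Coord → ℝ) → ℝ)
    (R : (Coord → ℝ) → (Fin (l + 1) → ℂ) → Fin (l + 1) → ℂ)
    (f : (Coord → ℝ) → (Fin (l + 1) → ℂ) → ℂ) : Prop :=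
  ∀ p ∈ equationOver Ω, ∀ θ,
    (∑ᶠ k, a k p • pd k (fun q => f q θ) p) + fderiv ℂ (f p) θ (R p θ) = 0

theorem IsSmoothOn.finite_support_pd (hopen : IsOpen Ω) (hf : IsSmoothOn Ω l f)
    (hp : p ∈ equationOver Ω) (θ : Fin (l + 1) → ℂ) :
    (support fun k => pd k (fun q => f q θ) p).Finite := by
  obtain ⟨K, hK⟩ := hf.exists_finset_pd_eq_zero hopen
  exact K.finite_toSet.subset fun k hk => by_contra fun hkK => hk (hK p hp θ k hkK)

theorem isFirstIntegral_dxCoord_iff (hopen : IsOpen Ω) (hf : IsSmoothOn Ω l f)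
    {G : ℕ → (Coord → ℝ) → ℝ} :
    IsFirstIntegral Ω (dxCoord G) R f ↔ ∀ p ∈ equationOver Ω, ∀ θ,
      dxWith G (fun q => f q θ) p + ∑ s, R p θ s * pdθ s (f p) θ = 0 :=
  forall₃_congr fun p hp θ => by
    rw [dxWith_eq_finsum G (hf.finite_support_pd hopen hp θ), sum_mul_pdθ (hf.holomorphic p hp)]

theorem isFirstIntegral_dyCoord_iff (hopen : IsOpen Ω) (hf : IsSmoothOn Ω l f)
    {Φ : ℕ → (Coord → ℝ) → ℝ} :
    IsFirstIntegral Ω (dyCoord Φ) R f ↔ ∀ p ∈ equationOver Ω, ∀ θ,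
      dyWith Φ (fun q => f q θ) p + ∑ s, R p θ s * pdθ s (f p) θ = 0 :=
  forall₃_congr fun p hp θ => by
    rw [dyWith_eq_finsum Φ (hf.finite_support_pd hopen hp θ), sum_mul_pdθ (hf.holomorphic p hp)]

variable {c n : Coord}

theorem IsFirstIntegral.exists_sub_add_eq_zero (hopen : IsOpen Ω) (hf : IsSmoothOn Ω l f)
    (h : IsFirstIntegral Ω a R f) (hc : IsLocallyIndep Ω f c)
    (ha : ∀ k ≠ n, IsLocallyIndep Ω f k ∨ DependsOn (a k) {c}ᶜ) (hp : p ∈ equationOver Ω)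
    (θ : Fin (l + 1) → ℂ) : ∃ t ≠ p c,
      (a n (update p c t) - a n p) • pd n (fun q => f q θ) p
        + fderiv ℂ (f p) θ (R (update p c t) θ - R p θ) = 0 := by
  obtain ⟨t, ht, hmem, hft, hpd⟩ := hc.exists_update hopen hf hp
  refine ⟨t, ht, ?_⟩
  have hfin (b : Coord → ℝ) : (support fun k => b k • pd k (fun q => f q θ) p).Finite :=
    (hf.finite_support_pd hopen hp θ).subset fun k hk => right_ne_zero_of_smul hk
  have hsum : (∑ᶠ k, a k (update p c t) • pd k (fun q => f q θ) p)
      - ∑ᶠ k, a k p • pd k (fun q => f q θ) p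
      = (a n (update p c t) - a n p) • pd n (fun q => f q θ) p := by
    rw [← finsum_sub_distrib (hfin _) (hfin _)]
    simp only [← sub_smul]
    refine finsum_eq_single _ n fun k hk => ?_
    obtain hk | hk := ha k hk
    · rw [hk p hp θ, smul_zero]
    · rw [hk fun i hi => update_of_ne hi t p, sub_self, zero_smul]
  have hp' := h _ hmem θ
  simp only [hpd, hft] at hp'
  rw [← hsum, map_sub]
  linear_combination hp' - h p hp θ

theorem IsFirstIntegral.isLocallyIndep (hopen : IsOpen Ω) (hf : IsSmoothOn Ω l f)
    (h : IsFirstIntegral Ω a R f) (hc : IsLocallyIndep Ω f c) (hn : ∀ p, a n p = p c)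
    (ha : ∀ k ≠ n, IsLocallyIndep Ω f k ∨ DependsOn (a k) {c}ᶜ) (hR : DependsOn R {c}ᶜ) :
    IsLocallyIndep Ω f n := fun p hp θ => by
  obtain ⟨t, ht, heq⟩ := h.exists_sub_add_eq_zero hopen hf hc ha hp θ
  rw [hR fun i hi => update_of_ne hi t p, sub_self, map_zero, add_zero, hn, hn, update_self] at heq
  exact (smul_eq_zero.mp heq).resolve_left (sub_ne_zero.mpr ht)

theorem IsFirstIntegral.fderiv_eq_zero (hopen : IsOpen Ω) (hf : IsSmoothOn Ω l f)
    (h : IsFirstIntegral Ω a R f) (hc : IsLocallyIndep Ω f c)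
    (ha : ∀ k, IsLocallyIndep Ω f k ∨ DependsOn (a k) {c}ᶜ) (hp : p ∈ equationOver Ω)
    {θ ξ : Fin (l + 1) → ℂ}
    (hR : ∀ t ≠ p c, ∃ κ : ℂ, κ ≠ 0 ∧ R (update p c t) θ - R p θ = κ • ξ) :
    fderiv ℂ (f p) θ ξ = 0 := by
  obtain ⟨t, ht, heq⟩ := h.exists_sub_add_eq_zero (n := c) hopen hf hc (fun k _ => ha k) hp θ
  obtain ⟨κ, hκ, hξ⟩ := hR t ht
  rw [hc p hp θ, smul_zero, zero_add, hξ, map_smul] at heq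
  exact (smul_eq_zero.mp heq).resolve_left hκ

end FirstIntegrals

section Descent

variable {Ω : Set (ℝ × ℝ × ℝ × ℝ)} {l : ℕ} {f : (Coord → ℝ) → (Fin (l + 1) → ℂ) → ℂ}
  {G Φ : ℕ → (Coord → ℝ) → ℝ} {S T : (Coord → ℝ) → (Fin (l + 1) → ℂ) → Fin (l + 1) → ℂ}
  {c k n : Coord} {i j N : ℕ}

theorem dependsOn_apply (h : k ≠ c) : DependsOn (fun p : Coord → ℝ => p k) {c}ᶜ :=
  fun _ _ hpq => hpq k h

theorem OrderLE.dependsOn_compl {F : Type*} {g : (Coord → ℝ) → F} (hg : OrderLE N g)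
    (hc : N < c.order) : DependsOn g {c}ᶜ :=
  fun p q hpq => hg p q fun k hk => hpq k fun hkc : k = c => (hkc ▸ hk).not_gt hc

theorem dependsOn_dxCoord_compl_u (hG : ∀ j, OrderLE (j + 1) (G j)) (hk : k.order ≤ i)
    (hne : k ≠ .u i) : DependsOn (dxCoord G k) {.u (i + 1)}ᶜ := by
  rcases k with _ | _ | _ | _ | _ | j
  exacts [fun _ _ _ => rfl, fun _ _ _ => rfl, dependsOn_apply (by simpa using hne),
    dependsOn_apply (by simp), dependsOn_apply (by simp),
    (hG j).dependsOn_compl (Nat.lt_succ_of_le hk)]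

theorem dependsOn_dxCoord_compl_uy (hG : ∀ j, OrderLE (j + 1) (G j)) (hk : k.order ≤ i + 1)
    (hne : k ≠ .uy i) : DependsOn (dxCoord G k) {.uy (i + 1)}ᶜ := by
  rcases k with _ | _ | _ | _ | _ | j
  exacts [fun _ _ _ => rfl, fun _ _ _ => rfl, dependsOn_apply (by simp),
    dependsOn_apply (by simpa using hne), dependsOn_apply (by simp),
    (hG j).dependsOn_compl (Nat.lt_succ_of_le hk)]

theorem dependsOn_dyCoord_compl_v (hΦ : ∀ i, OrderLE (i + 1) (Φ i)) (hk : k.order ≤ j)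
    (hne : k ≠ .v j) : DependsOn (dyCoord Φ k) {.v (j + 1)}ᶜ := by
  rcases k with _ | _ | _ | i | _ | _
  exacts [fun _ _ _ => rfl, fun _ _ _ => rfl, dependsOn_apply (by simp),
    (hΦ i).dependsOn_compl (Nat.lt_succ_of_le hk), dependsOn_apply (by simpa using hne),
    dependsOn_apply (by simp)]

theorem dependsOn_dyCoord_compl_vx (hΦ : ∀ i, OrderLE (i + 1) (Φ i)) (hk : k.order ≤ j + 1)
    (hne : k ≠ .vx j) : DependsOn (dyCoord Φ k) {.vx (j + 1)}ᶜ := by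
  rcases k with _ | _ | _ | i | _ | _
  exacts [fun _ _ _ => rfl, fun _ _ _ => rfl, dependsOn_apply (by simp),
    (hΦ i).dependsOn_compl (Nat.lt_succ_of_le hk), dependsOn_apply (by simp),
    dependsOn_apply (by simpa using hne)]

theorem isLocallyIndep_of_forall_order_lt (hopen : IsOpen Ω) (hf : IsSmoothOn Ω l f)
    (hG : ∀ j, OrderLE (j + 1) (G j)) (hΦ : ∀ i, OrderLE (i + 1) (Φ i))
    (hS : DependsOn S {.x, .y, .u 0, .uy 0, .v 0}) (hT : DependsOn T {.x, .y, .u 0, .v 0, .vx 0})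
    (hx : IsFirstIntegral Ω (dxCoord G) S f) (hy : IsFirstIntegral Ω (dyCoord Φ) T f)
    (hN : ∀ k : Coord, n.order < k.order → IsLocallyIndep Ω f k) (hnx : n ≠ .x) (hny : n ≠ .y) :
    IsLocallyIndep Ω f n := by
  have hsplit (k : Coord) : IsLocallyIndep Ω f k ∨ k.order ≤ n.order :=
    (lt_or_ge n.order k.order).imp_left (hN k)
  rcases n with _ | _ | i | i | j | j
  · exact absurd rfl hnx
  · exact absurd rfl hny
  · exact hx.isLocallyIndep hopen hf (hN (.u (i + 1)) (Nat.lt_succ_self _)) (fun _ => rfl)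
      (fun k hk => (hsplit k).imp_right fun h => dependsOn_dxCoord_compl_u hG h hk)
      (hS.mono (by simp))
  · exact hx.isLocallyIndep hopen hf (hN (.uy (i + 1)) (Nat.lt_succ_self _)) (fun _ => rfl)
      (fun k hk => (hsplit k).imp_right fun h => dependsOn_dxCoord_compl_uy hG h hk)
      (hS.mono (by simp))
  · exact hy.isLocallyIndep hopen hf (hN (.v (j + 1)) (Nat.lt_succ_self _)) (fun _ => rfl)
      (fun k hk => (hsplit k).imp_right fun h => dependsOn_dyCoord_compl_v hΦ h hk)
      (hT.mono (by simp))
  · exact hy.isLocallyIndep hopen hf (hN (.vx (j + 1)) (Nat.lt_succ_self _)) (fun _ => rfl)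
      (fun k hk => (hsplit k).imp_right fun h => dependsOn_dyCoord_compl_vx hΦ h hk)
      (hT.mono (by simp))

theorem isLocallyIndep_of_ne (hopen : IsOpen Ω) (hf : IsSmoothOn Ω l f)
    (hG : ∀ j, OrderLE (j + 1) (G j)) (hΦ : ∀ i, OrderLE (i + 1) (Φ i))
    (hS : DependsOn S {.x, .y, .u 0, .uy 0, .v 0}) (hT : DependsOn T {.x, .y, .u 0, .v 0, .vx 0})
    (hx : IsFirstIntegral Ω (dxCoord G) S f) (hy : IsFirstIntegral Ω (dyCoord Φ) T f)
    (n : Coord) (hnx : n ≠ .x) (hny : n ≠ .y) : IsLocallyIndep Ω f n := by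
  obtain ⟨K, hK⟩ := hf.exists_finset_pd_eq_zero hopen
  have htop (k : Coord) (hk : K.sup Coord.order < k.order) : IsLocallyIndep Ω f k :=
    fun p hp θ => hK p hp θ k fun hkK => hk.not_ge (Finset.le_sup hkK)
  have hdescent (d : ℕ) : ∀ k : Coord, k ≠ .x → k ≠ .y → K.sup Coord.order < k.order + d →
      IsLocallyIndep Ω f k := by
    induction d with
    | zero => exact fun k _ _ hk => htop k hk
    | succ d ih =>
      refine fun k hkx hky hk =>
        isLocallyIndep_of_forall_order_lt hopen hf hG hΦ hS hT hx hy (fun m hm => ?_) hkx hky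
      refine ih m ?_ ?_ (by omega) <;> rintro rfl <;> exact Nat.not_lt_zero _ hm
  exact hdescent (K.sup Coord.order + 1) n hnx hny (by omega)

end Descent

section Constancy

variable {Ω : Set (ℝ × ℝ × ℝ × ℝ)} {l : ℕ} {f : (Coord → ℝ) → (Fin (l + 1) → ℂ) → ℂ}
  {p : Coord → ℝ}

theorem tendsto_piecewise (T : Finset Coord) (p : Coord → ℝ) :
    Tendsto (fun q : Coord → ℝ => T.piecewise q p) (𝓝 p) (𝓝 p) := by
  have hcont : Continuous fun q : Coord → ℝ => T.piecewise q p := by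
    refine continuous_pi fun k => ?_
    by_cases hk : k ∈ T
    · simpa only [Finset.piecewise_eq_of_mem _ _ _ hk] using continuous_apply k
    · simpa only [Finset.piecewise_eq_of_notMem _ _ _ hk] using continuous_const
  simpa only [Finset.piecewise_same] using hcont.tendsto p

theorem IsSmoothOn.eventually_eq (hopen : IsOpen Ω) (hf : IsSmoothOn Ω l f)
    (hpd : ∀ k, IsLocallyIndep Ω f k) (hp : p ∈ equationOver Ω) :
    ∀ᶠ q in 𝓝[equationOver Ω] p, f p = f q := by
  obtain ⟨K, hK, -⟩ := hf.finite_order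
  have hpiecewise (T : Finset Coord) : ∀ᶠ q in 𝓝 p, f (T.piecewise q p) = f p := by
    induction T using Finset.induction_on with
    | empty => simp
    | insert k T _ ih =>
      have hlim := ((continuous_apply k).tendsto p).prodMk (tendsto_piecewise T p)
      filter_upwards [ih, hlim.eventually ((hpd k).eventually_update_eq hopen hf hp)] with q hq hqk
      rw [Finset.piecewise_insert, hqk, hq]
  have hmem := (tendsto_piecewise K p).eventually ((isOpen_equationOver hopen).eventually_mem hp)
  filter_upwards [nhdsWithin_le_nhds (hpiecewise K), nhdsWithin_le_nhds hmem,
    self_mem_nhdsWithin] with q hq hqK hqΩ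
  rw [← hq]
  exact hK _ hqK q hqΩ fun k hk => K.piecewise_eq_of_mem q p hk

theorem exists_const_of_isLocallyIndep (hopen : IsOpen Ω) (hconn : IsPreconnected Ω)
    (hf : IsSmoothOn Ω l f) (hpd : ∀ k, IsLocallyIndep Ω f k)
    (hfderiv : ∀ p ∈ equationOver Ω, ∀ θ, fderiv ℂ (f p) θ = 0) :
    ∃ c : ℂ, ∀ p ∈ equationOver Ω, ∀ θ, f p θ = c := by
  obtain hempty | ⟨p₀, hp₀⟩ := (equationOver Ω).eq_empty_or_nonempty
  · exact ⟨0, by simp [hempty]⟩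
  refine ⟨f p₀ 0, fun p hp θ => ?_⟩
  rw [is_const_of_fderiv_eq_zero (hf.holomorphic p hp) (hfderiv p hp) θ 0]
  exact congrFun ((isPreconnected_equationOver hconn).induction₂ (fun p q => f p = f q)
    (fun _ hq => hf.eventually_eq hopen hpd hq) (fun _ _ _ _ _ _ => Eq.trans)
    (fun _ _ _ _ => Eq.symm) hp hp₀) 0

theorem isFirstIntegral_of_eq_const (hopen : IsOpen Ω) {c : ℂ}
    (hc : ∀ p ∈ equationOver Ω, ∀ θ, f p θ = c) (a : Coord → (Coord → ℝ) → ℝ)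
    (R : (Coord → ℝ) → (Fin (l + 1) → ℂ) → Fin (l + 1) → ℂ) : IsFirstIntegral Ω a R f := by
  intro p hp θ
  have hpd (k : Coord) : pd k (fun q => f q θ) p = 0 :=
    pd_eq_zero_of_forall_update_eq hopen hp fun t ht => hc _ ht θ
  simp [hpd, show f p = fun _ => c from funext (hc p hp)]

end Constancy

section RiccatiFields

variable {l : ℕ}

theorem extend_apply (θ : Fin (l + 1) → ℂ) (s : Fin (l + 1)) : extend θ s = θ s :=
  dif_pos s.isLt

theorem extend_zero (θ : Fin (l + 1) → ℂ) : extend θ 0 = θ 0 :=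
  extend_apply θ 0

theorem extend_of_le (θ : Fin (l + 1) → ℂ) {n : ℕ} (hn : l + 1 ≤ n) : extend θ n = 0 :=
  dif_neg hn.not_gt

/-- The series `w₀ + w₁ μ + ⋯ + w_l μ^l`. -/
def truncSeries : (Fin (l + 1) → ℂ) →ₗ[ℂ] PowerSeries ℂ where
  toFun w := mk (extend w)
  map_add' w ξ := by
    ext n
    by_cases hn : n < l + 1 <;> simp only [coeff_mk, map_add, extend, hn, ↓reduceDIte,
      Pi.add_apply, add_zero]
  map_smul' t w := by
    ext n
    by_cases hn : n < l + 1 <;> simp only [coeff_mk, map_smul, extend, hn, ↓reduceDIte,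
      Pi.smul_apply, RingHom.id_apply, smul_zero]

theorem coeff_truncSeries (w : Fin (l + 1) → ℂ) (n : ℕ) :
    coeff n (truncSeries w) = extend w n :=
  coeff_mk n (extend w)

theorem coeff_mul_truncSeries_coeff (A B : PowerSeries ℂ) (s : Fin (l + 1)) :
    coeff s (A * truncSeries fun i : Fin (l + 1) => coeff i B) = coeff s (A * B) := by
  simp only [coeff_mul]
  refine Finset.sum_congr rfl fun ij hij => ?_
  have hlt : ij.2 < l + 1 := by
    have := Finset.HasAntidiagonal.mem_antidiagonal.mp hij
    omega
  rw [coeff_truncSeries]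
  exact congrArg _ (extend_apply (fun i : Fin (l + 1) => coeff i B) ⟨ij.2, hlt⟩)

/-- The vector field `w' = a + b w + c w²` on the truncated series `w₀ + ⋯ + w_l μ^l`. -/
def quadraticField (a b c : PowerSeries ℂ) (w : Fin (l + 1) → ℂ) (s : Fin (l + 1)) : ℂ :=
  coeff s (a + b * truncSeries w + c * truncSeries w ^ 2)

theorem hasDerivAt_quadraticField (a b c : PowerSeries ℂ) (w ξ : Fin (l + 1) → ℂ)
    (s : Fin (l + 1)) :
    HasDerivAt (fun t : ℂ => quadraticField a b c (w + t • ξ) s)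
      (coeff s ((b + 2 * c * truncSeries w) * truncSeries ξ)) 0 := by
  have hline : (fun t : ℂ => quadraticField a b c (w + t • ξ) s) = fun t =>
      quadraticField a b c w s + t * coeff s ((b + 2 * c * truncSeries w) * truncSeries ξ)
        + t ^ 2 * coeff s (c * truncSeries ξ ^ 2) := by
    funext t
    simp only [quadraticField, map_add, map_smul, ← coeff_C_mul, smul_eq_C_mul, map_pow]
    simp only [← map_add]
    congr 1
    ring
  have hlin := ((hasDerivAt_id (0 : ℂ)).mul_const
    (coeff s ((b + 2 * c * truncSeries w) * truncSeries ξ))).const_add (quadraticField a b c w s)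
  have hsq := (hasDerivAt_pow 2 (0 : ℂ)).mul_const (coeff s (c * truncSeries ξ ^ 2))
  rw [hline]
  simpa using hlin.fun_add hsq

theorem differentiable_coeff_mul {E : Type*} [NormedAddCommGroup E] [NormedSpace ℂ E]
    {A B : E → PowerSeries ℂ} (hA : ∀ n, Differentiable ℂ fun w => coeff n (A w))
    (hB : ∀ n, Differentiable ℂ fun w => coeff n (B w)) (n : ℕ) :
    Differentiable ℂ fun w => coeff n (A w * B w) := by
  simp only [coeff_mul]
  exact Differentiable.fun_sum fun ij _ => (hA ij.1).fun_mul (hB ij.2)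

theorem differentiable_quadraticField (a b c : PowerSeries ℂ) :
    Differentiable ℂ (quadraticField (l := l) a b c) := by
  have hconst (A : PowerSeries ℂ) (n : ℕ) :
      Differentiable ℂ fun _ : Fin (l + 1) → ℂ => coeff n A := differentiable_const _
  have hw (n : ℕ) : Differentiable ℂ fun w : Fin (l + 1) → ℂ => coeff n (truncSeries w) :=
    ((coeff n).comp truncSeries).toContinuousLinearMap.differentiable
  refine differentiable_pi.mpr fun s => ?_
  simp only [quadraticField, map_add, pow_two]
  exact ((hconst a s).fun_add (differentiable_coeff_mul (hconst b) hw s)).fun_add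
    (differentiable_coeff_mul (hconst c) (differentiable_coeff_mul hw hw) s)

theorem fderiv_quadraticField (a b c : PowerSeries ℂ) (w ξ : Fin (l + 1) → ℂ) :
    fderiv ℂ (quadraticField a b c) w ξ
      = fun s : Fin (l + 1) => coeff s ((b + 2 * c * truncSeries w) * truncSeries ξ) :=
  ((differentiable_quadraticField a b c w).hasFDerivAt.hasLineDerivAt ξ).unique
    (hasDerivAt_pi.mpr (hasDerivAt_quadraticField a b c w ξ))

theorem lieBracket_quadraticField (a b c a' b' c' : PowerSeries ℂ) (w : Fin (l + 1) → ℂ) :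
    VectorField.lieBracket ℂ (quadraticField a b c) (quadraticField a' b' c') w
      = quadraticField (a * b' - a' * b) (2 * (a * c' - a' * c)) (b * c' - b' * c) w := by
  funext s
  rw [VectorField.lieBracket, fderiv_quadraticField, fderiv_quadraticField, Pi.sub_apply]
  unfold quadraticField
  rw [coeff_mul_truncSeries_coeff, coeff_mul_truncSeries_coeff, ← map_sub]
  congr 1
  ring

/-- The coefficients `w₀, …, w_l` of the series `w` as functions of `θ₀, …, θ_l`. -/
def wCoord (θ : Fin (l + 1) → ℂ) (s : Fin (l + 1)) : ℂ :=
  coeff s (wSeries (extend θ))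

theorem wCoord_zero (θ : Fin (l + 1) → ℂ) : wCoord θ 0 = Complex.exp (θ 0) := by
  simp [wCoord, wSeries, extend_zero]

theorem wCoord_of_ne_zero (θ : Fin (l + 1) → ℂ) {s : Fin (l + 1)} (hs : s ≠ 0) :
    wCoord θ s = θ s * Complex.exp (θ 0) := by
  simp only [wCoord, wSeries, coeff_mk, extend_zero, extend_apply, Fin.val_eq_zero_iff, hs,
    if_false]

theorem contDiff_wCoord : ContDiff ℂ 2 (wCoord (l := l)) := by
  refine contDiff_pi.mpr fun s => ?_
  by_cases hs : s = 0
  · simp only [hs, wCoord_zero]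
    fun_prop
  · simp only [wCoord_of_ne_zero _ hs]
    fun_prop

theorem fderiv_wCoord (θ ξ : Fin (l + 1) → ℂ) :
    fderiv ℂ wCoord θ ξ = fun s =>
      Complex.exp (θ 0) * if s = 0 then ξ 0 else ξ s + θ s * ξ 0 := by
  have hdiff := (contDiff_wCoord.differentiable two_ne_zero θ).hasFDerivAt.hasLineDerivAt ξ
  refine hdiff.unique (hasDerivAt_pi.mpr fun s => ?_)
  have hline (s : Fin (l + 1)) : HasDerivAt (fun t : ℂ => (θ + t • ξ) s) (ξ s) 0 := by
    simpa using ((hasDerivAt_id (0 : ℂ)).mul_const (ξ s)).const_add (θ s)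
  by_cases hs : s = 0
  · simpa only [hs, wCoord_zero, if_true, zero_smul, add_zero] using (hline 0).cexp
  · have := (hline s).fun_mul (hline 0).cexp
    simp only [zero_smul, add_zero] at this
    simp only [wCoord_of_ne_zero _ hs, hs, if_false]
    exact this.congr_deriv (by ring)

theorem eq_zero_of_fderiv_wCoord_eq_zero {θ ξ : Fin (l + 1) → ℂ}
    (h : fderiv ℂ wCoord θ ξ = 0) : ξ = 0 := by
  rw [fderiv_wCoord] at h
  have hmul (s : Fin (l + 1)) : (if s = 0 then ξ 0 else ξ s + θ s * ξ 0) = 0 :=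
    (mul_eq_zero.mp (congrFun h s)).resolve_left (Complex.exp_ne_zero _)
  have h0 : ξ 0 = 0 := by simpa using hmul 0
  funext s
  by_cases hs : s = 0
  · simpa [hs] using h0
  · simpa [hs, h0] using hmul s

/-- The vector field on the fibre given by the Riccati equation `w' = a + b w + c w²`. -/
def riccatiField (a b c : PowerSeries ℂ) (θ : Fin (l + 1) → ℂ) (s : Fin (l + 1)) : ℂ :=
  thetaDot (a + b * wSeries (extend θ) + c * wSeries (extend θ) ^ 2) (extend θ) s

theorem truncSeries_wCoord (θ : Fin (l + 1) → ℂ) :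
    truncSeries (wCoord θ) = wSeries (extend θ) := by
  ext n
  rw [coeff_truncSeries]
  rcases lt_or_ge n (l + 1) with hn | hn
  · exact extend_apply (wCoord θ) ⟨n, hn⟩
  · have hn0 : n ≠ 0 := by omega
    simp only [extend_of_le _ hn, wSeries, coeff_mk, hn0, if_false, zero_mul]

theorem riccatiField_apply (a b c : PowerSeries ℂ) (θ : Fin (l + 1) → ℂ) (s : Fin (l + 1)) :
    riccatiField a b c θ s = Complex.exp (-θ 0) * quadraticField a b c (wCoord θ) s
      - if s = 0 then 0 else θ s * (Complex.exp (-θ 0) * quadraticField a b c (wCoord θ) 0) := by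
  simp only [riccatiField, thetaDot, quadraticField, truncSeries_wCoord, extend_zero, extend_apply,
    Fin.val_eq_zero_iff]
  split_ifs with hs
  · simp [hs]
  · rfl

theorem differentiable_riccatiField (a b c : PowerSeries ℂ) :
    Differentiable ℂ (riccatiField (l := l) a b c) := by
  have hq (s : Fin (l + 1)) : Differentiable ℂ fun θ => quadraticField a b c (wCoord θ) s :=
    differentiable_pi.mp ((differentiable_quadraticField a b c).comp
      (contDiff_wCoord.differentiable two_ne_zero)) s
  refine differentiable_pi.mpr fun s => ?_
  simp only [riccatiField_apply]
  split_ifs <;> fun_prop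

theorem fderiv_wCoord_riccatiField (a b c : PowerSeries ℂ) (θ : Fin (l + 1) → ℂ) :
    fderiv ℂ wCoord θ (riccatiField a b c θ) = quadraticField a b c (wCoord θ) := by
  have hexp : Complex.exp (θ 0) * Complex.exp (-θ 0) = 1 := by
    rw [← Complex.exp_add, add_neg_cancel, Complex.exp_zero]
  rw [fderiv_wCoord]
  funext s
  by_cases hs : s = 0
  · simp only [hs, riccatiField_apply, if_true, sub_zero, ← mul_assoc, hexp, one_mul]
  · simp only [hs, riccatiField_apply, if_true, if_false, sub_zero, sub_add_cancel, ← mul_assoc,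
      hexp, one_mul]

theorem lieBracket_riccatiField (a b c a' b' c' : PowerSeries ℂ) (θ : Fin (l + 1) → ℂ) :
    VectorField.lieBracket ℂ (riccatiField a b c) (riccatiField a' b' c') θ
      = riccatiField (a * b' - a' * b) (2 * (a * c' - a' * c)) (b * c' - b' * c) θ := by
  have hfderiv (a b c a' b' c' : PowerSeries ℂ) :
      fderiv ℂ (fun θ => fderiv ℂ wCoord θ (riccatiField a b c θ)) θ (riccatiField a' b' c' θ)
        = fderiv ℂ (quadraticField a b c) (wCoord θ) (quadraticField a' b' c' (wCoord θ)) := by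
    simp only [fderiv_wCoord_riccatiField]
    rw [← fderiv_wCoord_riccatiField, ← ContinuousLinearMap.comp_apply]
    exact DFunLike.congr_fun (fderiv_comp θ (differentiable_quadraticField a b c _)
      (contDiff_wCoord.differentiable two_ne_zero θ)) _
  refine sub_eq_zero.mp (eq_zero_of_fderiv_wCoord_eq_zero (θ := θ) ?_)
  rw [map_sub, fderiv_wCoord_riccatiField, VectorField.fderiv_apply_lieBracket
    contDiff_wCoord.contDiffAt (by simp [minSmoothness_of_isRCLikeNormedField])
    (differentiable_riccatiField _ _ _ θ) (differentiable_riccatiField _ _ _ θ),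
    hfderiv, hfderiv, ← lieBracket_quadraticField, VectorField.lieBracket, sub_self]

theorem riccatiField_add (a b c a' b' c' : PowerSeries ℂ) (θ : Fin (l + 1) → ℂ) :
    riccatiField (a + a') (b + b') (c + c') θ = riccatiField a b c θ + riccatiField a' b' c' θ := by
  funext s
  simp only [riccatiField, thetaDot, map_add, add_mul, Pi.add_apply]
  split_ifs <;> ring

theorem riccatiField_C_mul (t : ℂ) (a b c : PowerSeries ℂ) (θ : Fin (l + 1) → ℂ) :
    riccatiField (C t * a) (C t * b) (C t * c) θ = t • riccatiField a b c θ := by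
  funext s
  simp only [riccatiField, thetaDot, map_add, mul_assoc, coeff_C_mul, Pi.smul_apply, smul_eq_mul]
  split_ifs <;> ring

theorem riccatiField_X_pow_mul_of_lt (a b c : PowerSeries ℂ) (θ : Fin (l + 1) → ℂ) {n : ℕ}
    {s : Fin (l + 1)} (hs : s < n) :
    riccatiField (X ^ n * a) (X ^ n * b) (X ^ n * c) θ s = 0 := by
  have hn : 0 ≠ n := by omega
  simp only [riccatiField, mul_assoc, ← mul_add, thetaDot, coeff_X_pow_mul', hs.not_ge,
    nonpos_iff_eq_zero, hn.symm, if_false, mul_zero, sub_zero, ite_self]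

theorem riccatiField_X_pow_mul_self (a b c : PowerSeries ℂ) (θ : Fin (l + 1) → ℂ)
    (n : Fin (l + 1)) :
    riccatiField (X ^ (n : ℕ) * a) (X ^ (n : ℕ) * b) (X ^ (n : ℕ) * c) θ n
      = Complex.exp (-θ 0) * (constantCoeff a + constantCoeff b * Complex.exp (θ 0)
        + constantCoeff c * Complex.exp (θ 0) ^ 2) := by
  have hw : constantCoeff (wSeries (extend θ)) = Complex.exp (θ 0) := by
    rw [← coeff_zero_eq_constantCoeff_apply, wSeries, coeff_mk, if_pos rfl, extend_zero]
  rcases eq_or_ne (n : ℕ) 0 with hn | hn <;>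
    simp [riccatiField, thetaDot, mul_assoc, ← mul_add, coeff_X_pow_mul', extend_zero, hn, hw]

end RiccatiFields

section RiccatiInvariants

theorem eq_zero_of_triangular {K M : Type*} [DivisionRing K] [AddCommGroup M] [Module K M] {m : ℕ}
    (L : (Fin m → K) →ₗ[K] M)
    (h : ∀ n, ∃ v, L v = 0 ∧ v n ≠ 0 ∧ ∀ k < n, v k = 0) : L = 0 := by
  refine LinearMap.pi_ext' fun n => LinearMap.ext_ring ?_
  induction n using WellFoundedGT.induction with
  | ind n ih =>
    obtain ⟨v, hLv, hvn, hlt⟩ := h n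
    have hLsingle (k : Fin m) : L (Pi.single k (v k)) = v k • L (Pi.single k 1) := by
      rw [← map_smul, ← Pi.single_smul, smul_eq_mul, mul_one]
    have hsum : ∑ k, v k • L (Pi.single k 1) = 0 := by
      rw [← hLv, ← Finset.univ_sum_single v, map_sum]
      simp only [hLsingle, Finset.univ_sum_single]
    rw [Finset.sum_eq_single n] at hsum
    · simpa [hvn] using hsum
    · intro k _ hk
      rcases hk.lt_or_gt with hlt' | hgt
      · rw [hlt k hlt', zero_smul]
      · have hsingle : L (Pi.single k 1) = 0 := by simpa using ih k hgt
        rw [hsingle, smul_zero]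
    · simp

variable {l : ℕ} {g : (Fin (l + 1) → ℂ) → ℂ}

/-- `g` is constant along the vector field on the fibre given by `w' = a + b w + c w²`. -/
def IsRiccatiInvariant (g : (Fin (l + 1) → ℂ) → ℂ) (a b c : PowerSeries ℂ) : Prop :=
  ∀ θ, fderiv ℂ g θ (riccatiField a b c θ) = 0

theorem IsRiccatiInvariant.add {a b c a' b' c' : PowerSeries ℂ} (h : IsRiccatiInvariant g a b c)
    (h' : IsRiccatiInvariant g a' b' c') :
    IsRiccatiInvariant g (a + a') (b + b') (c + c') := fun θ => by
  rw [riccatiField_add, map_add, h θ, h' θ, add_zero]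

theorem IsRiccatiInvariant.lieBracket (hg : ContDiff ℝ 2 g) (hg' : Differentiable ℂ g)
    {a b c a' b' c' : PowerSeries ℂ} (h : IsRiccatiInvariant g a b c)
    (h' : IsRiccatiInvariant g a' b' c') :
    IsRiccatiInvariant g (a * b' - a' * b) (2 * (a * c' - a' * c)) (b * c' - b' * c) := by
  have hV := differentiable_riccatiField (l := l) a b c
  have hW := differentiable_riccatiField (l := l) a' b' c'
  intro θ
  have hreal : VectorField.lieBracket ℂ (riccatiField a b c) (riccatiField a' b' c') θ
      = VectorField.lieBracket ℝ (riccatiField a b c) (riccatiField a' b' c') θ := by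
    simp only [VectorField.lieBracket, (hV θ).fderiv_restrictScalars ℝ,
      (hW θ).fderiv_restrictScalars ℝ, ContinuousLinearMap.coe_restrictScalars']
  have hgreal (ξ : Fin (l + 1) → ℂ) (θ) : fderiv ℂ g θ ξ = fderiv ℝ g θ ξ := by
    rw [(hg' θ).fderiv_restrictScalars ℝ, ContinuousLinearMap.coe_restrictScalars']
  have hzero : (fun θ => fderiv ℝ g θ (riccatiField a b c θ)) = fun _ => 0 :=
    funext fun θ => (hgreal _ θ).symm.trans (h θ)
  have hzero' : (fun θ => fderiv ℝ g θ (riccatiField a' b' c' θ)) = fun _ => 0 :=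
    funext fun θ => (hgreal _ θ).symm.trans (h' θ)
  rw [← lieBracket_riccatiField, hreal, hgreal, VectorField.fderiv_apply_lieBracket hg.contDiffAt
    (by simp [minSmoothness_of_isRCLikeNormedField]) ((hW θ).restrictScalars ℝ)
    ((hV θ).restrictScalars ℝ), hzero, hzero']
  simp

theorem IsRiccatiInvariant.exists_odd (hg : ContDiff ℝ 2 g) (hg' : Differentiable ℂ g)
    {q s₁ s₂ : PowerSeries ℂ} (hq : constantCoeff q ≠ 0) (hs₁ : constantCoeff s₁ ≠ 0)
    (hs₂ : constantCoeff s₂ ≠ 0) (h : IsRiccatiInvariant g 0 (X ^ 2 * q) 0)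
    (h₁ : IsRiccatiInvariant g (X * s₁) 0 (X * s₁))
    (h₂ : IsRiccatiInvariant g (X * s₂) 0 (-(X * s₂))) (n : ℕ) :
    ∃ a b, constantCoeff a ≠ 0 ∧ constantCoeff b ≠ 0 ∧
      IsRiccatiInvariant g (X ^ (2 * n + 1) * a) 0 (X ^ (2 * n + 1) * a) ∧
      IsRiccatiInvariant g (X ^ (2 * n + 1) * b) 0 (-(X ^ (2 * n + 1) * b)) := by
  induction n with
  | zero => exact ⟨s₁, s₂, hs₁, hs₂, by simpa using h₁, by simpa using h₂⟩
  | succ n ih =>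
    obtain ⟨a, b, ha, hb, hinva, hinvb⟩ := ih
    refine ⟨-(q * b), -(q * a), by simp [hq, hb], by simp [hq, ha], ?_, ?_⟩
    · convert h.lieBracket hg hg' hinvb using 1 <;> ring
    · convert h.lieBracket hg hg' hinva using 1 <;> ring

theorem IsRiccatiInvariant.even (hg : ContDiff ℝ 2 g) (hg' : Differentiable ℂ g)
    {a b : PowerSeries ℂ} {m n : ℕ} (ha : IsRiccatiInvariant g (X ^ m * a) 0 (X ^ m * a))
    (hb : IsRiccatiInvariant g (X ^ n * b) 0 (-(X ^ n * b))) :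
    IsRiccatiInvariant g 0 (X ^ (m + n) * (-(4 * a * b))) 0 := by
  convert ha.lieBracket hg hg' hb using 1 <;> ring

theorem IsRiccatiInvariant.exists_leading {a b c : PowerSeries ℂ} {n : Fin (l + 1)}
    (h : IsRiccatiInvariant g (X ^ (n : ℕ) * a) (X ^ (n : ℕ) * b) (X ^ (n : ℕ) * c))
    {θ : Fin (l + 1) → ℂ} (hne : constantCoeff a + constantCoeff b * Complex.exp (θ 0)
      + constantCoeff c * Complex.exp (θ 0) ^ 2 ≠ 0) :
    ∃ ξ, fderiv ℂ g θ ξ = 0 ∧ ξ n ≠ 0 ∧ ∀ k < n, ξ k = 0 := by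
  refine ⟨_, h θ, ?_, fun k hk => riccatiField_X_pow_mul_of_lt a b c θ hk⟩
  rw [riccatiField_X_pow_mul_self]
  exact mul_ne_zero (Complex.exp_ne_zero _) hne

theorem fderiv_eq_zero_of_isRiccatiInvariant (hg : ContDiff ℝ 2 g) (hg' : Differentiable ℂ g)
    {r q s₁ s₂ : PowerSeries ℂ} (hr : constantCoeff r ≠ 0) (hq : constantCoeff q ≠ 0)
    (hs₁ : constantCoeff s₁ ≠ 0) (hs₂ : constantCoeff s₂ ≠ 0)
    (h₀ : IsRiccatiInvariant g 0 r 0) (h : IsRiccatiInvariant g 0 (X ^ 2 * q) 0)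
    (h₁ : IsRiccatiInvariant g (X * s₁) 0 (X * s₁))
    (h₂ : IsRiccatiInvariant g (X * s₂) 0 (-(X * s₂))) (θ : Fin (l + 1) → ℂ) :
    fderiv ℂ g θ = 0 := by
  have hodd := IsRiccatiInvariant.exists_odd hg hg' hq hs₁ hs₂ h h₁ h₂
  refine ContinuousLinearMap.coe_injective (eq_zero_of_triangular _ fun n => ?_)
  obtain ⟨m, hn | hn⟩ := Nat.even_or_odd' n
  · rcases m with _ | m
    · exact IsRiccatiInvariant.exists_leading (a := 0) (b := r) (c := 0) (by simpa [hn] using h₀)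
        (by simpa using hr)
    · obtain ⟨a, -, ha, -, hinva, -⟩ := hodd m
      have hinv : IsRiccatiInvariant g 0 (X ^ (n : ℕ) * -(4 * a * s₂)) 0 := by
        rw [hn]
        exact hinva.even hg hg' (n := 1) (by rwa [pow_one])
      have h4 : constantCoeff (-(4 * a * s₂)) ≠ 0 := by
        simp [map_ofNat (constantCoeff (R := ℂ)) 4, ha, hs₂]
      exact IsRiccatiInvariant.exists_leading (a := 0) (b := -(4 * a * s₂)) (c := 0)
        (by rwa [mul_zero])
        (by simpa only [map_zero, zero_add, zero_mul, add_zero]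
          using mul_ne_zero h4 (Complex.exp_ne_zero _))
  · obtain ⟨a, b, ha, hb, hinva, hinvb⟩ := hodd m
    rw [← hn] at hinva hinvb
    -- `1 + e^{2θ₀}` and `1 - e^{2θ₀}` cannot both vanish.
    by_cases hexp : 1 + Complex.exp (θ 0) ^ 2 = 0
    · refine IsRiccatiInvariant.exists_leading (a := b) (b := 0) (c := -b) (by simpa using hinvb)
        fun h => hb ?_
      simp only [map_zero, map_neg] at h
      linear_combination (h + constantCoeff b * hexp) / 2
    · refine IsRiccatiInvariant.exists_leading (a := a) (b := 0) (c := a) (by simpa using hinva) ?_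
      simpa [← mul_one_add] using And.intro ha hexp

end RiccatiInvariants

section Series

theorem constantCoeff_taylorSeries (φ : ℝ → ℝ) : constantCoeff (taylorSeries φ) = φ 0 := by
  simp [← coeff_zero_eq_constantCoeff_apply, taylorSeries]

theorem constantCoeff_invSqrtSeries (c : ℝ) : constantCoeff (invSqrtSeries c) = 1 := by
  simp [invSqrtSeries, constantCoeff_taylorSeries]

theorem constantCoeff_sqrtRatioSeries (c d : ℝ) : constantCoeff (sqrtRatioSeries c d) = 1 := by
  simp [sqrtRatioSeries, constantCoeff_taylorSeries]

theorem eventually_one_add_mul_sq_pos (c : ℝ) : ∀ᶠ μ in 𝓝 (0 : ℝ), 0 < 1 + c * μ ^ 2 := by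
  have hcont : ContinuousAt (fun μ : ℝ => 1 + c * μ ^ 2) 0 := by fun_prop
  exact hcont.eventually_const_lt (by simp)

theorem hasDerivAt_sqrtRatio {c d μ : ℝ} (hc : 0 < 1 + c * μ ^ 2) (hd : 0 < 1 + d * μ ^ 2) :
    HasDerivAt (fun μ : ℝ => √((1 + c * μ ^ 2) / (1 + d * μ ^ 2)))
      (μ * ((c - d) / (√((1 + c * μ ^ 2) / (1 + d * μ ^ 2)) * (1 + d * μ ^ 2) ^ 2))) μ := by
  have hquad (k : ℝ) : HasDerivAt (fun μ : ℝ => 1 + k * μ ^ 2) (k * (2 * μ)) μ := by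
    simpa using ((hasDerivAt_pow 2 μ).const_mul k).const_add 1
  refine (((hquad c).fun_div (hquad d) hd.ne').sqrt (div_pos hc hd).ne').congr_deriv ?_
  field_simp
  ring

theorem coeff_one_sqrtRatioSeries (c d : ℝ) : coeff 1 (sqrtRatioSeries c d) = 0 := by
  have h := hasDerivAt_sqrtRatio (c := c) (d := d) (μ := 0) (by simp) (by simp)
  simp [sqrtRatioSeries, taylorSeries, iteratedDeriv_one, h.deriv]

theorem coeff_two_sqrtRatioSeries (c d : ℝ) :
    coeff 2 (sqrtRatioSeries c d) = ((c - d) / 2 : ℝ) := by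
  have hderiv : deriv (fun μ : ℝ => √((1 + c * μ ^ 2) / (1 + d * μ ^ 2))) =ᶠ[𝓝 0] fun μ =>
      μ * ((c - d) / (√((1 + c * μ ^ 2) / (1 + d * μ ^ 2)) * (1 + d * μ ^ 2) ^ 2)) := by
    filter_upwards [eventually_one_add_mul_sq_pos c, eventually_one_add_mul_sq_pos d] with μ hc hd
    exact (hasDerivAt_sqrtRatio hc hd).deriv
  have hderiv₂ : HasDerivAt (fun μ : ℝ =>
      μ * ((c - d) / (√((1 + c * μ ^ 2) / (1 + d * μ ^ 2)) * (1 + d * μ ^ 2) ^ 2))) (c - d) 0 := by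
    have hfactor : DifferentiableAt ℝ (fun μ : ℝ =>
        (c - d) / (√((1 + c * μ ^ 2) / (1 + d * μ ^ 2)) * (1 + d * μ ^ 2) ^ 2)) 0 := by
      fun_prop (disch := simp)
    simpa using (hasDerivAt_id (0 : ℝ)).fun_mul hfactor.hasDerivAt
  have hiter : iteratedDeriv 2 (fun μ : ℝ => √((1 + c * μ ^ 2) / (1 + d * μ ^ 2))) 0 = c - d := by
    rw [iteratedDeriv_succ, iteratedDeriv_one, hderiv.deriv_eq, hderiv₂.deriv]
  rw [sqrtRatioSeries, taylorSeries, coeff_mk, hiter, Nat.factorial_two, Nat.cast_ofNat]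

theorem sqrtRatioSeries_sub (c d : ℝ) : ∃ q : PowerSeries ℂ,
    sqrtRatioSeries c d - sqrtRatioSeries d c = X ^ 2 * q ∧ constantCoeff q = (c - d : ℝ) := by
  obtain ⟨q, hq⟩ : X ^ 2 ∣ sqrtRatioSeries c d - sqrtRatioSeries d c := by
    refine X_pow_dvd_iff.mpr fun m hm => ?_
    interval_cases m
    · simp [constantCoeff_sqrtRatioSeries]
    · simp [coeff_one_sqrtRatioSeries]
  refine ⟨q, hq, ?_⟩
  have hcoeff := congrArg (coeff 2) hq
  rw [map_sub, coeff_two_sqrtRatioSeries, coeff_two_sqrtRatioSeries, coeff_X_pow_mul',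
    if_pos le_rfl, Nat.sub_self, coeff_zero_eq_constantCoeff_apply] at hcoeff
  rw [← hcoeff, ← Complex.ofReal_sub]
  congr 1
  ring

end Series

section Covering

variable {Ω : Set (ℝ × ℝ × ℝ × ℝ)} {l : ℕ} {f : (Coord → ℝ) → (Fin (l + 1) → ℂ) → ℂ}
  {G Φ : ℕ → (Coord → ℝ) → ℝ} {η₁ η₂ : ℝ → ℝ} {p : Coord → ℝ}

/-- The right-hand sides `θ_{0,x}, …, θ_{l,x}`. -/
def coveringX (η₁ η₂ : ℝ → ℝ) (p : Coord → ℝ) (θ : Fin (l + 1) → ℂ) (s : Fin (l + 1)) : ℂ :=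
  thetaDot (riccatiX η₁ η₂ p (extend θ)) (extend θ) s

/-- The right-hand sides `θ_{0,y}, …, θ_{l,y}`. -/
def coveringY (η₁ η₂ : ℝ → ℝ) (p : Coord → ℝ) (θ : Fin (l + 1) → ℂ) (s : Fin (l + 1)) : ℂ :=
  thetaDot (riccatiY η₁ η₂ p (extend θ)) (extend θ) s

theorem coveringX_eq (η₁ η₂ : ℝ → ℝ) (p : Coord → ℝ) (θ : Fin (l + 1) → ℂ) :
    coveringX η₁ η₂ p θ
      = (Complex.I * (p (.uy 0) / p (.v 0) : ℝ)) •
          riccatiField 0 (sqrtRatioSeries (η₂ (p .y)) (η₁ (p .x))) 0 θ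
        + ((p (.u 0) / 2 : ℝ) : ℂ) •
          riccatiField (X * invSqrtSeries (η₁ (p .x))) 0 (X * invSqrtSeries (η₁ (p .x))) θ := by
  rw [← riccatiField_C_mul, ← riccatiField_C_mul, ← riccatiField_add]
  funext s
  simp only [coveringX, riccatiField, riccatiX]
  congr 1
  ring

theorem coveringY_eq (η₁ η₂ : ℝ → ℝ) (p : Coord → ℝ) (θ : Fin (l + 1) → ℂ) :
    coveringY η₁ η₂ p θ
      = (Complex.I * (p (.vx 0) / p (.u 0) : ℝ)) •
          riccatiField 0 (-sqrtRatioSeries (η₁ (p .x)) (η₂ (p .y))) 0 θ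
        + (Complex.I * (p (.v 0) / 2 : ℝ)) •
          riccatiField (X * invSqrtSeries (η₂ (p .y))) 0 (-(X * invSqrtSeries (η₂ (p .y)))) θ := by
  rw [← riccatiField_C_mul, ← riccatiField_C_mul, ← riccatiField_add]
  funext s
  simp only [coveringY, riccatiField, riccatiY]
  congr 1
  ring

theorem dependsOn_coveringX (η₁ η₂ : ℝ → ℝ) :
    DependsOn (coveringX (l := l) η₁ η₂) {.x, .y, .u 0, .uy 0, .v 0} := fun p q hpq => by
  funext θ
  rw [coveringX_eq, coveringX_eq, hpq .x (by simp), hpq .y (by simp), hpq (.u 0) (by simp),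
    hpq (.uy 0) (by simp), hpq (.v 0) (by simp)]

theorem dependsOn_coveringY (η₁ η₂ : ℝ → ℝ) :
    DependsOn (coveringY (l := l) η₁ η₂) {.x, .y, .u 0, .v 0, .vx 0} := fun p q hpq => by
  funext θ
  rw [coveringY_eq, coveringY_eq, hpq .x (by simp), hpq .y (by simp), hpq (.u 0) (by simp),
    hpq (.v 0) (by simp), hpq (.vx 0) (by simp)]

theorem dxCoord_isLocallyIndep_or_dependsOn
    (hindep : ∀ k : Coord, k ≠ .x → k ≠ .y → IsLocallyIndep Ω f k)
    (G : ℕ → (Coord → ℝ) → ℝ) (c k : Coord) :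
    IsLocallyIndep Ω f k ∨ DependsOn (dxCoord G k) {c}ᶜ := by
  rcases k with _ | _ | _ | _ | _ | _
  exacts [.inr fun _ _ _ => rfl, .inr fun _ _ _ => rfl, .inl (hindep _ nofun nofun),
    .inl (hindep _ nofun nofun), .inl (hindep _ nofun nofun), .inl (hindep _ nofun nofun)]

theorem dyCoord_isLocallyIndep_or_dependsOn
    (hindep : ∀ k : Coord, k ≠ .x → k ≠ .y → IsLocallyIndep Ω f k)
    (Φ : ℕ → (Coord → ℝ) → ℝ) (c k : Coord) :
    IsLocallyIndep Ω f k ∨ DependsOn (dyCoord Φ k) {c}ᶜ := by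
  rcases k with _ | _ | _ | _ | _ | _
  exacts [.inr fun _ _ _ => rfl, .inr fun _ _ _ => rfl, .inl (hindep _ nofun nofun),
    .inl (hindep _ nofun nofun), .inl (hindep _ nofun nofun), .inl (hindep _ nofun nofun)]

theorem isRiccatiInvariant_of_coveringX (hopen : IsOpen Ω) (hf : IsSmoothOn Ω l f)
    (hindep : ∀ k : Coord, k ≠ .x → k ≠ .y → IsLocallyIndep Ω f k)
    (hx : IsFirstIntegral Ω (dxCoord G) (coveringX η₁ η₂) f) (hp : p ∈ equationOver Ω)
    (hv : p (.v 0) ≠ 0) :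
    IsRiccatiInvariant (f p) 0 (sqrtRatioSeries (η₂ (p .y)) (η₁ (p .x))) 0 ∧
      IsRiccatiInvariant (f p) (X * invSqrtSeries (η₁ (p .x))) 0
        (X * invSqrtSeries (η₁ (p .x))) := by
  refine ⟨fun θ => hx.fderiv_eq_zero hopen hf (hindep (.uy 0) nofun nofun)
      (dxCoord_isLocallyIndep_or_dependsOn hindep G _) hp fun t ht =>
        ⟨Complex.I * ((t - p (.uy 0)) / p (.v 0) : ℝ), ?_, ?_⟩,
    fun θ => hx.fderiv_eq_zero hopen hf (hindep (.u 0) nofun nofun)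
      (dxCoord_isLocallyIndep_or_dependsOn hindep G _) hp fun t ht =>
        ⟨((t - p (.u 0)) / 2 : ℝ), ?_, ?_⟩⟩
  · exact mul_ne_zero Complex.I_ne_zero
      (Complex.ofReal_ne_zero.mpr (div_ne_zero (sub_ne_zero.mpr ht) hv))
  · simp only [coveringX_eq, update_self, ne_eq, reduceCtorEq, not_false_eq_true, update_of_ne]
    rw [add_sub_add_right_eq_sub, ← sub_smul, ← mul_sub, ← Complex.ofReal_sub, ← sub_div]
  · exact Complex.ofReal_ne_zero.mpr (div_ne_zero (sub_ne_zero.mpr ht) two_ne_zero)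
  · simp only [coveringX_eq, update_self, ne_eq, reduceCtorEq, not_false_eq_true, update_of_ne]
    rw [add_sub_add_left_eq_sub, ← sub_smul, ← Complex.ofReal_sub, ← sub_div]

theorem isRiccatiInvariant_of_coveringY (hopen : IsOpen Ω) (hf : IsSmoothOn Ω l f)
    (hindep : ∀ k : Coord, k ≠ .x → k ≠ .y → IsLocallyIndep Ω f k)
    (hy : IsFirstIntegral Ω (dyCoord Φ) (coveringY η₁ η₂) f) (hp : p ∈ equationOver Ω)
    (hu : p (.u 0) ≠ 0) :
    IsRiccatiInvariant (f p) 0 (-sqrtRatioSeries (η₁ (p .x)) (η₂ (p .y))) 0 ∧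
      IsRiccatiInvariant (f p) (X * invSqrtSeries (η₂ (p .y))) 0
        (-(X * invSqrtSeries (η₂ (p .y)))) := by
  refine ⟨fun θ => hy.fderiv_eq_zero hopen hf (hindep (.vx 0) nofun nofun)
      (dyCoord_isLocallyIndep_or_dependsOn hindep Φ _) hp fun t ht =>
        ⟨Complex.I * ((t - p (.vx 0)) / p (.u 0) : ℝ), ?_, ?_⟩,
    fun θ => hy.fderiv_eq_zero hopen hf (hindep (.v 0) nofun nofun)
      (dyCoord_isLocallyIndep_or_dependsOn hindep Φ _) hp fun t ht =>
        ⟨Complex.I * ((t - p (.v 0)) / 2 : ℝ), ?_, ?_⟩⟩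
  · exact mul_ne_zero Complex.I_ne_zero
      (Complex.ofReal_ne_zero.mpr (div_ne_zero (sub_ne_zero.mpr ht) hu))
  · simp only [coveringY_eq, update_self, ne_eq, reduceCtorEq, not_false_eq_true, update_of_ne]
    rw [add_sub_add_right_eq_sub, ← sub_smul, ← mul_sub, ← Complex.ofReal_sub, ← sub_div]
  · exact mul_ne_zero Complex.I_ne_zero
      (Complex.ofReal_ne_zero.mpr (div_ne_zero (sub_ne_zero.mpr ht) two_ne_zero))
  · simp only [coveringY_eq, update_self, ne_eq, reduceCtorEq, not_false_eq_true, update_of_ne]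
    rw [add_sub_add_left_eq_sub, ← sub_smul, ← mul_sub, ← Complex.ofReal_sub, ← sub_div]

theorem fderiv_eq_zero_of_isFirstIntegral (hopen : IsOpen Ω) (hf : IsSmoothOn Ω l f)
    (hindep : ∀ k : Coord, k ≠ .x → k ≠ .y → IsLocallyIndep Ω f k)
    (hx : IsFirstIntegral Ω (dxCoord G) (coveringX η₁ η₂) f)
    (hy : IsFirstIntegral Ω (dyCoord Φ) (coveringY η₁ η₂) f) (hp : p ∈ equationOver Ω)
    (hu : p (.u 0) ≠ 0) (hv : p (.v 0) ≠ 0) (hη : η₁ (p .x) ≠ η₂ (p .y))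
    (θ : Fin (l + 1) → ℂ) : fderiv ℂ (f p) θ = 0 := by
  obtain ⟨hr, hs₁⟩ := isRiccatiInvariant_of_coveringX hopen hf hindep hx hp hv
  obtain ⟨hr', hs₂⟩ := isRiccatiInvariant_of_coveringY hopen hf hindep hy hp hu
  obtain ⟨q, hdvd, hq⟩ := sqrtRatioSeries_sub (η₂ (p .y)) (η₁ (p .x))
  have hq₀ : constantCoeff q ≠ 0 :=
    hq ▸ Complex.ofReal_ne_zero.mpr (sub_ne_zero.mpr hη.symm)
  have hinvq : IsRiccatiInvariant (f p) 0 (X ^ 2 * q) 0 := by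
    simpa only [add_zero, ← sub_eq_add_neg, hdvd] using hr.add hr'
  exact fderiv_eq_zero_of_isRiccatiInvariant
    (contDiff_infty.mp (hf.contDiff hopen hp) 2) (hf.holomorphic p hp)
    (by simp [constantCoeff_sqrtRatioSeries]) hq₀ (by simp [constantCoeff_invSqrtSeries])
    (by simp [constantCoeff_invSqrtSeries]) hr hinvq hs₁ hs₂ θ

end Covering

section Reduction

variable {Ω : Set (ℝ × ℝ × ℝ × ℝ)} {l : ℕ} {f : (Coord → ℝ) → (Fin (l + 1) → ℂ) → ℂ}

theorem IsFirstIntegral.isLocallyIndep_of_coeff_eq_one {a : Coord → (Coord → ℝ) → ℝ}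
    {R : (Coord → ℝ) → (Fin (l + 1) → ℂ) → Fin (l + 1) → ℂ} {n : Coord}
    (h : IsFirstIntegral Ω a R f) (hn : ∀ p, a n p = 1)
    (ha : ∀ k ≠ n, IsLocallyIndep Ω f k ∨ ∀ p, a k p = 0)
    (hfderiv : ∀ p ∈ equationOver Ω, ∀ θ, fderiv ℂ (f p) θ = 0) : IsLocallyIndep Ω f n :=
  fun p hp θ => by
    have hsum : (∑ᶠ k, a k p • pd k (fun q => f q θ) p) = pd n (fun q => f q θ) p := by
      rw [finsum_eq_single _ n fun k hk => ?_, hn, one_smul]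
      obtain hk | hk := ha k hk
      · rw [hk p hp θ, smul_zero]
      · rw [hk p, zero_smul]
    simpa only [hsum, hfderiv p hp θ, zero_apply, add_zero] using h p hp θ

theorem exists_const_of_isFirstIntegral {G Φ : ℕ → (Coord → ℝ) → ℝ} {η₁ η₂ : ℝ → ℝ}
    (hopen : IsOpen Ω) (hconn : IsPreconnected Ω)
    (hΩ : ∀ x y u v : ℝ, (x, y, u, v) ∈ Ω → u ≠ 0 ∧ v ≠ 0 ∧ η₁ x ≠ η₂ y)
    (hG : ∀ j, OrderLE (j + 1) (G j)) (hΦ : ∀ i, OrderLE (i + 1) (Φ i)) (hf : IsSmoothOn Ω l f)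
    (hx : IsFirstIntegral Ω (dxCoord G) (coveringX η₁ η₂) f)
    (hy : IsFirstIntegral Ω (dyCoord Φ) (coveringY η₁ η₂) f) :
    ∃ c : ℂ, ∀ p ∈ equationOver Ω, ∀ θ, f p θ = c := by
  have hindep := isLocallyIndep_of_ne hopen hf hG hΦ (dependsOn_coveringX η₁ η₂)
    (dependsOn_coveringY η₁ η₂) hx hy
  have hfderiv : ∀ p ∈ equationOver Ω, ∀ θ, fderiv ℂ (f p) θ = 0 := fun p hp =>
    have ⟨hu, hv, hη⟩ := hΩ _ _ _ _ hp
    fderiv_eq_zero_of_isFirstIntegral hopen hf hindep hx hy hp hu hv hη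
  refine exists_const_of_isLocallyIndep hopen hconn hf (fun k => ?_) hfderiv
  by_cases hkx : k = .x
  · subst hkx
    refine hx.isLocallyIndep_of_coeff_eq_one (fun _ => rfl) (fun k hk => ?_) hfderiv
    exact (ne_or_eq k .y).imp (hindep k hk) fun hky _ => by rw [hky]; rfl
  by_cases hky : k = .y
  · subst hky
    refine hy.isLocallyIndep_of_coeff_eq_one (fun _ => rfl) (fun k hk => ?_) hfderiv
    exact (ne_or_eq k .x).imp (hindep k · hk) fun hkx _ => by rw [hkx]; rfl
  exact hindep k hkx hky

end Reduction

end SDeformable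

end

theorem mainTheorem1_general (η₁ η₂ : ℝ → ℝ) (Ω : Set (ℝ × ℝ × ℝ × ℝ))
    (hopen : IsOpen Ω) (hconn : IsPreconnected Ω)
    (hΩ : ∀ x y u v : ℝ, (x, y, u, v) ∈ Ω → u ≠ 0 ∧ v ≠ 0 ∧ η₁ x ≠ η₂ y)
    (G Φ : ℕ → (SDeformable.Coord → ℝ) → ℝ)
    (hG : ∀ j, SDeformable.OrderLE (j + 1) (G j)) (hΦ : ∀ i, SDeformable.OrderLE (i + 1) (Φ i))
    (l : ℕ) (f : (SDeformable.Coord → ℝ) → (Fin (l + 1) → ℂ) → ℂ)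
    (hf : SDeformable.IsSmoothOn Ω l f) :
    (∀ p ∈ SDeformable.equationOver Ω, ∀ θ : Fin (l + 1) → ℂ,
        SDeformable.dxWith G (fun q => f q θ) p
            + ∑ s, SDeformable.coveringX η₁ η₂ p θ s * SDeformable.pdθ s (f p) θ = 0 ∧
          SDeformable.dyWith Φ (fun q => f q θ) p
            + ∑ s, SDeformable.coveringY η₁ η₂ p θ s * SDeformable.pdθ s (f p) θ = 0) ↔
      ∃ c : ℂ, ∀ p ∈ SDeformable.equationOver Ω, ∀ θ : Fin (l + 1) → ℂ, f p θ = c := by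
  rw [forall₂_congr fun _ _ => forall_and, forall₂_and,
    ← SDeformable.isFirstIntegral_dxCoord_iff hopen hf,
    ← SDeformable.isFirstIntegral_dyCoord_iff hopen hf]
  refine ⟨fun ⟨hx, hy⟩ =>
    SDeformable.exists_const_of_isFirstIntegral hopen hconn hΩ hG hΦ hf hx hy, ?_⟩
  rintro ⟨c, hc⟩
  exact ⟨SDeformable.isFirstIntegral_of_eq_const hopen hc _ _,
    SDeformable.isFirstIntegral_of_eq_const hopen hc _ _⟩

theorem mainTheorem1 (η₁ η₂ : ℝ → ℝ) (Ω : Set (ℝ × ℝ × ℝ × ℝ))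
    (hopen : IsOpen Ω) (hconn : IsPreconnected Ω)
    (hη : ∀ x y u v : ℝ, (x, y, u, v) ∈ Ω → ContDiffAt ℝ ∞ η₁ x ∧ ContDiffAt ℝ ∞ η₂ y)
    (hΩ : ∀ x y u v : ℝ, (x, y, u, v) ∈ Ω → u ≠ 0 ∧ v ≠ 0 ∧ η₁ x ≠ η₂ y)
    (l : ℕ) (f : (SDeformable.Coord → ℝ) → (Fin (l + 1) → ℂ) → ℂ)
    (hf : SDeformable.IsSmoothOn Ω l f) :
    (∀ p ∈ SDeformable.equationOver Ω, ∀ θ : Fin (l + 1) → ℂ,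
        SDeformable.DxL η₁ η₂ l f p θ = 0 ∧ SDeformable.DyL η₁ η₂ l f p θ = 0) ↔
      ∃ c : ℂ, ∀ p ∈ SDeformable.equationOver Ω, ∀ θ : Fin (l + 1) → ℂ, f p θ = c :=
  mainTheorem1_general η₁ η₂ Ω hopen hconn hΩ (SDeformable.vxx η₁ η₂) (SDeformable.uyy η₁ η₂)
    (fun j => (SDeformable.orderLE_uyy_vxx η₁ η₂ j j le_rfl).2)
    (fun i => (SDeformable.orderLE_uyy_vxx η₁ η₂ i i le_rfl).1) l f hf
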